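/- **Load balanced demand distribution (LBDD).** An instance with $n \ge 1$ demand units $d_1,\dots,d_n$ and $k \ge 1$ service centers $s_1,\dots,s_k$ consists of positive costs $CM(d,s_i)$ of assigning the demand unit $d$ to $s_i$, a positive integer capacity $c_i$ for each $s_i$, and for each $s_i$ a penalty function $q_i$, where $q_i(j)$ is the extra cost paid for the $j$-th demand unit that $s_i$ receives beyond its capacity; $q_i$ is positive and monotonically increasing (not necessarily strictly) on $1 \le j \le n-c_i$. Costs and penalties are real numbers (in particular, they may be integers). An allotment $A$ assigns every demand unit to exactly one service center. With $o_i = |A^{-1}(s_i)|$, its cost is $$\sum_{i=1}^{k}\Big(\sum_{d \,:\, A(d)=s_i} CM(d,s_i) \;+\; \sum_{j=1}^{\max(o_i-c_i,\,0)} q_i(j)\Big),$$ and $A$ is optimal if no allotment has smaller cost. **Model of computation.** A unit-cost random access machine whose words are natural numbers (for counting and addressing, with addition, truncated subtraction, halving and comparison) and real numbers (with addition, subtraction and comparison); every elementary operation, memory access and branch takes one step. An instance is given in memory by $n$, $k$, the array of capacities, the $n \times k$ cost matrix and a table of the values $q_i(j)$, $1 \le j \le n - c_i$. **Theorem.** An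 optimal allotment for an LBDD instance with $n$ demand units and $k$ service centers can be computed in time $O(nk^3 + nk^2\log n)$. That is, there are a single program and an absolute constant $C$ such that for all $n, k \ge 1$ and every LBDD instance with $n$ demand units and $k$ service centers, the program halts after at most $C\,(nk^3 + nk^2\log n)$ steps with an optimal allotment in memory. -/

import Mathlib

namespace LBDD

/-! ## The load balanced demand distribution problem -/

/-- An instance with `n` demand units and `k` service centers. `penalty i j` is the extra cost paid
for the `j`-th demand unit (`j = 1, 2, …`) that center `i` receives beyond its capacity; it matters,
and is constrained, only for `1 ≤ j ≤ n - capacity i`. -/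
structure Inst (n k : ℕ) where
  cost : Fin n → Fin k → ℝ
  capacity : Fin k → ℕ
  penalty : Fin k → ℕ → ℝ
  cost_pos : ∀ d i, 0 < cost d i
  capacity_pos : ∀ i, 0 < capacity i
  penalty_pos : ∀ i j, 1 ≤ j → capacity i + j ≤ n → 0 < penalty i j
  penalty_mono : ∀ i j j', 1 ≤ j → j ≤ j' → capacity i + j' ≤ n → penalty i j ≤ penalty i j'

/-- The demand units that the allotment `A` assigns to center `i`. -/
def allotted {n k : ℕ} (A : Fin n → Fin k) (i : Fin k) : Finset (Fin n) :=
  Finset.univ.filter fun d => A d = i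

/-- The number of demand units that `A` assigns to center `i`. -/
def occupancy {n k : ℕ} (A : Fin n → Fin k) (i : Fin k) : ℕ :=
  (allotted A i).card

/-- The objective function. The truncated difference `occupancy A i - capacity i` is the number of
demand units by which center `i` is overloaded (`0` if it is not overloaded). -/
noncomputable def Inst.totalCost {n k : ℕ} (I : Inst n k) (A : Fin n → Fin k) : ℝ :=
  ∑ i, ((∑ d ∈ allotted A i, I.cost d i) +
    ∑ j ∈ Finset.Icc 1 (occupancy A i - I.capacity i), I.penalty i j)

def Inst.IsOptimal {n k : ℕ} (I : Inst n k) (A : Fin n → Fin k) : Prop :=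
  ∀ B : Fin n → Fin k, I.totalCost A ≤ I.totalCost B

/-! ## Random access machine programs

A structured programming language for the unit-cost random access machine. There are two kinds of
data, natural numbers (used for counting and addressing) and real numbers (costs), which are never
converted into each other. Both are held in scalar variables and in arrays. On natural numbers the
machine can add, subtract (truncated at `0`), halve (rounding down) and compare; on real numbers it
can add, subtract and compare. There is no multiplication. -/

structure State where
  natVar : ℕ → ℕ
  natArr : ℕ → ℕ → ℕ
  realVar : ℕ → ℝ
  realArr : ℕ → ℕ → ℝ

inductive NatExpr where
  | const (c : ℕ)
  | var (x : ℕ)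
  | arr (a : ℕ) (i : NatExpr)
  | add (e f : NatExpr)
  | sub (e f : NatExpr)
  | half (e : NatExpr)

def NatExpr.eval (s : State) : NatExpr → ℕ
  | const c => c
  | var x => s.natVar x
  | arr a i => s.natArr a (i.eval s)
  | add e f => e.eval s + f.eval s
  | sub e f => e.eval s - f.eval s
  | half e => e.eval s / 2

/-- The number of elementary operations that an evaluation takes. -/
def NatExpr.steps : NatExpr → ℕ
  | const _ => 1
  | var _ => 1
  | arr _ i => i.steps + 1
  | add e f => e.steps + f.steps + 1
  | sub e f => e.steps + f.steps + 1
  | half e => e.steps + 1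

inductive RealExpr where
  | zero
  | var (x : ℕ)
  | arr (a : ℕ) (i : NatExpr)
  | add (e f : RealExpr)
  | sub (e f : RealExpr)

noncomputable def RealExpr.eval (s : State) : RealExpr → ℝ
  | zero => 0
  | var x => s.realVar x
  | arr a i => s.realArr a (i.eval s)
  | add e f => e.eval s + f.eval s
  | sub e f => e.eval s - f.eval s

def RealExpr.steps : RealExpr → ℕ
  | zero => 1
  | var _ => 1
  | arr _ i => i.steps + 1
  | add e f => e.steps + f.steps + 1
  | sub e f => e.steps + f.steps + 1

inductive Test where
  | natLt (e f : NatExpr)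
  | natEq (e f : NatExpr)
  | realLt (e f : RealExpr)
  | neg (b : Test)
  | conj (b c : Test)

def Test.Holds (s : State) : Test → Prop
  | natLt e f => e.eval s < f.eval s
  | natEq e f => e.eval s = f.eval s
  | realLt e f => e.eval s < f.eval s
  | neg b => ¬ b.Holds s
  | conj b c => b.Holds s ∧ c.Holds s

def Test.steps : Test → ℕ
  | natLt e f => e.steps + f.steps + 1
  | natEq e f => e.steps + f.steps + 1
  | realLt e f => e.steps + f.steps + 1
  | neg b => b.steps + 1
  | conj b c => b.steps + c.steps + 1

inductive Prog where
  | skip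
  | setNat (x : ℕ) (e : NatExpr)
  | setReal (x : ℕ) (e : RealExpr)
  | storeNat (a : ℕ) (i e : NatExpr)
  | storeReal (a : ℕ) (i : NatExpr) (e : RealExpr)
  | seq (p q : Prog)
  | cond (b : Test) (p q : Prog)
  | loop (b : Test) (p : Prog)

def State.setNat (s : State) (x v : ℕ) : State :=
  { s with natVar := Function.update s.natVar x v }

noncomputable def State.setReal (s : State) (x : ℕ) (v : ℝ) : State :=
  { s with realVar := Function.update s.realVar x v }

def State.storeNat (s : State) (a i v : ℕ) : State :=
  { s with natArr := Function.update s.natArr a (Function.update (s.natArr a) i v) }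

noncomputable def State.storeReal (s : State) (a i : ℕ) (v : ℝ) : State :=
  { s with realArr := Function.update s.realArr a (Function.update (s.realArr a) i v) }

/-- `Run p s t s'`: started in state `s`, the program `p` halts after exactly `t` elementary steps
in state `s'`. `loop b p` repeats `p` as long as `b` holds. -/
inductive Run : Prog → State → ℕ → State → Prop where
  | skip (s : State) : Run .skip s 1 s
  | setNat (x : ℕ) (e : NatExpr) (s : State) :
      Run (.setNat x e) s (e.steps + 1) (s.setNat x (e.eval s))
  | setReal (x : ℕ) (e : RealExpr) (s : State) :
      Run (.setReal x e) s (e.steps + 1) (s.setReal x (e.eval s))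
  | storeNat (a : ℕ) (i e : NatExpr) (s : State) :
      Run (.storeNat a i e) s (i.steps + e.steps + 1) (s.storeNat a (i.eval s) (e.eval s))
  | storeReal (a : ℕ) (i : NatExpr) (e : RealExpr) (s : State) :
      Run (.storeReal a i e) s (i.steps + e.steps + 1) (s.storeReal a (i.eval s) (e.eval s))
  | seq {p q : Prog} {s s' s'' : State} {t t' : ℕ} (hp : Run p s t s') (hq : Run q s' t' s'') :
      Run (.seq p q) s (t + t') s''
  | condTrue {b : Test} {p : Prog} (q : Prog) {s s' : State} {t : ℕ} (hb : b.Holds s)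
      (hp : Run p s t s') : Run (.cond b p q) s (b.steps + t + 1) s'
  | condFalse {b : Test} (p : Prog) {q : Prog} {s s' : State} {t : ℕ} (hb : ¬ b.Holds s)
      (hq : Run q s t s') : Run (.cond b p q) s (b.steps + t + 1) s'
  | loopDone {b : Test} (p : Prog) {s : State} (hb : ¬ b.Holds s) :
      Run (.loop b p) s (b.steps + 1) s
  | loopStep {b : Test} {p : Prog} {s s' s'' : State} {t t' : ℕ} (hb : b.Holds s)
      (hp : Run p s t s') (hl : Run (.loop b p) s' t' s'') :
      Run (.loop b p) s (b.steps + t + t' + 1) s''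

/-! ## Input and output -/

/-- The memory `s` holds the instance `I`: the numbers `n` and `k` in two scalar variables, the
capacities in an array, the cost matrix row by row in another, and the penalty functions as a
`k × n` table whose entry in row `i` and column `j` (both counted from `0`) is `penalty i (j + 1)`
wherever that is relevant. The remaining memory may have any contents. -/
structure Inst.LoadedIn {n k : ℕ} (I : Inst n k) (s : State) : Prop where
  demandCount : s.natVar 0 = n
  centerCount : s.natVar 1 = k
  capacities : ∀ i : Fin k, s.natArr 0 i = I.capacity i
  costs : ∀ (d : Fin n) (i : Fin k), s.realArr 0 (d * k + i) = I.cost d i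
  penalties : ∀ (i : Fin k) (j : ℕ), I.capacity i + (j + 1) ≤ n →
    s.realArr 1 (i * n + j) = I.penalty i (j + 1)

/-- The memory `s` holds the allotment `A`, as an array indexed by the demand units. -/
def Outputs {n k : ℕ} (A : Fin n → Fin k) (s : State) : Prop :=
  ∀ d : Fin n, s.natArr 1 d = A d

end LBDD

/-! The objective is a linear assignment cost plus, for each center, a convex function of its
occupancy, since the marginal penalties `I.marginal i` are monotone. Optimality is therefore
certified by prices: every demand unit sits at a center minimising cost plus price, and each price
lies between the marginal penalty of the last unit received and that of the next one. Summing these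
inequalities is weak duality (`Inst.isOptimal_of_prices`).

Demand units are inserted one at a time, and such prices `y` are kept for the units already
inserted. A new unit `m` calls for a shortest path in a graph on the centers: `m` enters `j` at
length `C m j`, and the edge from `i` to `j` has length `min (C d j - C d i)` over the units `d` at
`i`. These lengths may be negative, but they become nonnegative when reduced by the prices, so
Dijkstra's algorithm works with `D j + y j` (`Searching.step`). The path ends where `D` plus the
next marginal penalty attains its minimum `L`. Raising each price to `max (y i) (L - D i)` keeps all
inequalities and makes the moves along the path tight (`Searching.finish`), so units can be shifted
along it without losing the certificate (`Augmenting.step`, `insert_ends`).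

A tournament tree for each ordered pair of centers yields the minimising `d` in constant time, so a
search costs O(k²). A path has at most k moves; each changes one leaf in the trees of at most two
centers, which costs O(k log n). With O(nk²) for the initialization the total is O(nk²(1 + log n)),
which lies within the claimed bound. Correctness and step counts are proved together through `Ends`.
-/

namespace LBDD

/-! ## Reasoning about programs -/

/-- The natural number variables that a program may write. -/
def Prog.natVars : Prog → List ℕ
  | .setNat x _ => [x]
  | .seq p q => p.natVars ++ q.natVars
  | .cond _ p q => p.natVars ++ q.natVars
  | .loop _ p => p.natVars
  | _ => []

/-- The real variables that a program may write. -/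
def Prog.realVars : Prog → List ℕ
  | .setReal x _ => [x]
  | .seq p q => p.realVars ++ q.realVars
  | .cond _ p q => p.realVars ++ q.realVars
  | .loop _ p => p.realVars
  | _ => []

/-- The arrays of natural numbers that a program may write. -/
def Prog.natArrs : Prog → List ℕ
  | .storeNat a _ _ => [a]
  | .seq p q => p.natArrs ++ q.natArrs
  | .cond _ p q => p.natArrs ++ q.natArrs
  | .loop _ p => p.natArrs
  | _ => []

/-- The arrays of real numbers that a program may write. -/
def Prog.realArrs : Prog → List ℕ
  | .storeReal a _ _ => [a]
  | .seq p q => p.realArrs ++ q.realArrs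
  | .cond _ p q => p.realArrs ++ q.realArrs
  | .loop _ p => p.realArrs
  | _ => []

/-- The states `s` and `s'` agree on all memory that `p` does not write. -/
structure Prog.Frame (p : Prog) (s s' : State) : Prop where
  natVar : ∀ x, x ∉ p.natVars → s'.natVar x = s.natVar x
  realVar : ∀ x, x ∉ p.realVars → s'.realVar x = s.realVar x
  natArr : ∀ a, a ∉ p.natArrs → s'.natArr a = s.natArr a
  realArr : ∀ a, a ∉ p.realArrs → s'.realArr a = s.realArr a

theorem Prog.Frame.refl (p : Prog) (s : State) : p.Frame s s :=
  ⟨fun _ _ => rfl, fun _ _ => rfl, fun _ _ => rfl, fun _ _ => rfl⟩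

theorem Prog.Frame.trans {p : Prog} {s s' s'' : State} (h : p.Frame s s') (h' : p.Frame s' s'') :
    p.Frame s s'' :=
  ⟨fun x hx => (h'.natVar x hx).trans (h.natVar x hx),
    fun x hx => (h'.realVar x hx).trans (h.realVar x hx),
    fun x hx => (h'.natArr x hx).trans (h.natArr x hx),
    fun x hx => (h'.realArr x hx).trans (h.realArr x hx)⟩

theorem Prog.Frame.mono {p q : Prog} {s s' : State} (h : p.Frame s s')
    (h₁ : p.natVars ⊆ q.natVars) (h₂ : p.realVars ⊆ q.realVars) (h₃ : p.natArrs ⊆ q.natArrs)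
    (h₄ : p.realArrs ⊆ q.realArrs) : q.Frame s s' :=
  ⟨fun x hx => h.natVar x fun hp => hx (h₁ hp), fun x hx => h.realVar x fun hp => hx (h₂ hp),
    fun x hx => h.natArr x fun hp => hx (h₃ hp), fun x hx => h.realArr x fun hp => hx (h₄ hp)⟩

theorem Prog.Frame.seq_left {p q : Prog} {s s' : State} (h : p.Frame s s') :
    (Prog.seq p q).Frame s s' :=
  h.mono (List.subset_append_left _ _) (List.subset_append_left _ _)
    (List.subset_append_left _ _) (List.subset_append_left _ _)

theorem Prog.Frame.seq_right {p q : Prog} {s s' : State} (h : q.Frame s s') :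
    (Prog.seq p q).Frame s s' :=
  h.mono (List.subset_append_right _ _) (List.subset_append_right _ _)
    (List.subset_append_right _ _) (List.subset_append_right _ _)

theorem Prog.Frame.loop {b : Test} {p : Prog} {s s' : State} (h : p.Frame s s') :
    (Prog.loop b p).Frame s s' :=
  ⟨h.natVar, h.realVar, h.natArr, h.realArr⟩

/-- Carries facts about untouched memory across a program; for a concrete program the side
conditions are decidable list memberships. -/
theorem Run.frame {p : Prog} {s s' : State} {t : ℕ} (h : Run p s t s') : p.Frame s s' := by
  induction h with
  | skip s => exact .refl _ s
  | setNat x e s =>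
    refine ⟨fun y hy => ?_, fun _ _ => rfl, fun _ _ => rfl, fun _ _ => rfl⟩
    exact Function.update_of_ne (fun h => hy (by simp [Prog.natVars, h])) _ _
  | setReal x e s =>
    refine ⟨fun _ _ => rfl, fun y hy => ?_, fun _ _ => rfl, fun _ _ => rfl⟩
    exact Function.update_of_ne (fun h => hy (by simp [Prog.realVars, h])) _ _
  | storeNat a i e s =>
    refine ⟨fun _ _ => rfl, fun _ _ => rfl, fun y hy => ?_, fun _ _ => rfl⟩
    exact Function.update_of_ne (fun h => hy (by simp [Prog.natArrs, h])) _ _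
  | storeReal a i e s =>
    refine ⟨fun _ _ => rfl, fun _ _ => rfl, fun _ _ => rfl, fun y hy => ?_⟩
    exact Function.update_of_ne (fun h => hy (by simp [Prog.realArrs, h])) _ _
  | seq _ _ hp hq => exact hp.seq_left.trans hq.seq_right
  | condTrue q _ _ hp =>
    exact hp.mono (List.subset_append_left _ _) (List.subset_append_left _ _)
      (List.subset_append_left _ _) (List.subset_append_left _ _)
  | condFalse p _ _ hp =>
    exact hp.mono (List.subset_append_right _ _) (List.subset_append_right _ _)
      (List.subset_append_right _ _) (List.subset_append_right _ _)
  | loopDone p _ => exact .refl _ _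
  | loopStep _ _ _ hp hl => exact hp.loop.trans hl

/-- Started in `s`, the program `p` halts within `T` steps in a state that satisfies `Q`. -/
def Ends (p : Prog) (s : State) (T : ℕ) (Q : State → Prop) : Prop :=
  ∃ t s', Run p s t s' ∧ t ≤ T ∧ Q s'

theorem Ends.mono {p : Prog} {s : State} {T T' : ℕ} {Q Q' : State → Prop} (h : Ends p s T Q)
    (hT : T ≤ T') (hQ : ∀ s', p.Frame s s' → Q s' → Q' s') : Ends p s T' Q' := by
  obtain ⟨t, s', hr, ht, hq⟩ := h
  exact ⟨t, s', hr, ht.trans hT, hQ s' hr.frame hq⟩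

theorem Ends.imp {p : Prog} {s : State} {T : ℕ} {Q Q' : State → Prop} (h : Ends p s T Q)
    (hQ : ∀ s', p.Frame s s' → Q s' → Q' s') : Ends p s T Q' :=
  h.mono le_rfl hQ

theorem Ends.seq {p q : Prog} {s : State} {T T' : ℕ} {R Q : State → Prop} (hp : Ends p s T R)
    (hq : ∀ s', p.Frame s s' → R s' → Ends q s' T' Q) : Ends (.seq p q) s (T + T') Q := by
  obtain ⟨t, s', hr, ht, hR⟩ := hp
  obtain ⟨t', s'', hr', ht', hQ⟩ := hq s' hr.frame hR
  exact ⟨t + t', s'', .seq hr hr', by omega, hQ⟩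

theorem Ends.cond {b : Test} {p q : Prog} {s : State} {T : ℕ} {Q : State → Prop}
    (hp : b.Holds s → Ends p s T Q) (hq : ¬ b.Holds s → Ends q s T Q) :
    Ends (.cond b p q) s (b.steps + T + 1) Q := by
  by_cases hb : b.Holds s
  · obtain ⟨t, s', hr, ht, hQ⟩ := hp hb
    exact ⟨_, s', .condTrue q hb hr, by omega, hQ⟩
  · obtain ⟨t, s', hr, ht, hQ⟩ := hq hb
    exact ⟨_, s', .condFalse p hb hr, by omega, hQ⟩

/-- A loop whose body decreases the measure `μ` and preserves `Inv`. -/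
theorem Ends.loop {b : Test} {p : Prog} {T : ℕ} (Inv : State → Prop) (μ : State → ℕ)
    (hstep : ∀ s, Inv s → b.Holds s → Ends p s T fun s' => Inv s' ∧ μ s' < μ s)
    {s : State} (hs : Inv s) :
    Ends (.loop b p) s (μ s * (T + b.steps + 1) + b.steps + 1)
      fun s' => Inv s' ∧ ¬ b.Holds s' := by
  induction hm : μ s using Nat.strong_induction_on generalizing s with
  | _ m ih =>
    by_cases hb : b.Holds s
    · obtain ⟨t, s', hr, ht, hI, hlt⟩ := hstep s hs hb
      obtain ⟨t', s'', hr', ht', hQ⟩ := ih (μ s') (hm ▸ hlt) hI rfl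
      refine ⟨_, s'', .loopStep hb hr hr', ?_, hQ⟩
      have : (μ s' + 1) * (T + b.steps + 1) ≤ m * (T + b.steps + 1) :=
        Nat.mul_le_mul_right _ (by omega)
      rw [Nat.add_mul] at this
      omega
    · exact ⟨_, s, .loopDone p hb, by omega, hs, hb⟩

/-- `for x = 0, 1, …, y - 1` do `p`, where `x` and `y` are variables. -/
def Prog.forLoop (x y : ℕ) (p : Prog) : Prog :=
  .seq (.setNat x (.const 0))
    (.loop (.natLt (.var x) (.var y)) (.seq p (.setNat x (.add (.var x) (.const 1)))))

/-- Per iteration, the 8 extra steps are 3 for the test, 4 for the increment and 1 for the loop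
step; the final 6 are 2 for the initial assignment and 4 for the failing test. The invariant must
not depend on the counter as stored in memory, hence `hInv`. -/
theorem Ends.forLoop {x y : ℕ} {p : Prog} {s : State} {B T : ℕ} (Inv : ℕ → State → Prop)
    (hy : y ∉ (Prog.forLoop x y p).natVars) (hB : s.natVar y = B) (hx : x ∉ p.natVars)
    (hInv : ∀ i s' v, Inv i s' → Inv i (s'.setNat x v)) (h0 : Inv 0 s)
    (hstep : ∀ i < B, ∀ s', (Prog.forLoop x y p).Frame s s' → s'.natVar x = i → Inv i s' →
      Ends p s' T (Inv (i + 1))) :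
    Ends (Prog.forLoop x y p) s (B * (T + 8) + 6) (Inv B) := by
  have hfr : (Prog.forLoop x y p).Frame s (s.setNat x 0) :=
    Prog.Frame.seq_left (Run.setNat x (.const 0) s).frame
  have hl := Ends.loop (b := .natLt (.var x) (.var y))
    (p := .seq p (.setNat x (.add (.var x) (.const 1)))) (T := T + 4)
    (fun s' => (Prog.forLoop x y p).Frame s s' ∧ s'.natVar x ≤ B ∧ Inv (s'.natVar x) s')
    (fun s' => B - s'.natVar x) (fun s' hs hb => ?_) (s := s.setNat x 0)
    ⟨hfr, by simp [State.setNat], by simpa [State.setNat] using hInv 0 s 0 h0⟩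
  · obtain ⟨t, s', hr, ht, ⟨hf, hle, hi⟩, hb⟩ := hl
    refine ⟨_, s', .seq (.setNat x (.const 0) s) hr, ?_, ?_⟩
    · simp [State.setNat, Test.steps, NatExpr.steps] at ht ⊢
      have : B * (T + 4 + 3 + 1) = B * (T + 8) := by ring
      omega
    · have hyB : s'.natVar y = B := (hf.natVar y hy).trans hB
      simp only [Test.Holds, NatExpr.eval, hyB] at hb
      have : s'.natVar x = B := by omega
      rwa [this] at hi
  · obtain ⟨hf, -, hi⟩ := hs
    have hyB : s'.natVar y = B := (hf.natVar y hy).trans hB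
    simp only [Test.Holds, NatExpr.eval, hyB] at hb
    obtain ⟨t, s₁, hr, ht, hq⟩ := hstep _ hb s' hf rfl hi
    have hx' : s₁.natVar x = s'.natVar x := hr.frame.natVar x hx
    have hrun := Run.seq hr (Run.setNat x (.add (.var x) (.const 1)) s₁)
    refine ⟨_, _, hrun, ?_, ⟨hf.trans (Prog.Frame.seq_right hrun.frame.loop), ?_, ?_⟩, ?_⟩
    · simp [NatExpr.steps]; omega
    · simp [State.setNat, NatExpr.eval]; omega
    · simpa [State.setNat, NatExpr.eval, hx'] using hInv _ _ (s'.natVar x + 1) hq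
    · simp [State.setNat, NatExpr.eval]; omega

/-! ### Symbolic execution of loop-free programs. -/

/-- An upper bound on the number of steps of a program without loops. -/
def Prog.steps : Prog → ℕ
  | .skip => 1
  | .setNat _ e => e.steps + 1
  | .setReal _ e => e.steps + 1
  | .storeNat _ i e => i.steps + e.steps + 1
  | .storeReal _ i e => i.steps + e.steps + 1
  | .seq p q => p.steps + q.steps
  | .cond b p q => b.steps + max p.steps q.steps + 1
  | .loop _ _ => 0

/-- The weakest precondition of a program without loops. -/
def Prog.wp : Prog → (State → Prop) → State → Prop
  | .skip, Q, s => Q s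
  | .setNat x e, Q, s => Q (s.setNat x (e.eval s))
  | .setReal x e, Q, s => Q (s.setReal x (e.eval s))
  | .storeNat a i e, Q, s => Q (s.storeNat a (i.eval s) (e.eval s))
  | .storeReal a i e, Q, s => Q (s.storeReal a (i.eval s) (e.eval s))
  | .seq p q, Q, s => p.wp (q.wp Q) s
  | .cond b p q, Q, s => (b.Holds s → p.wp Q s) ∧ (¬ b.Holds s → q.wp Q s)
  | .loop _ _, _, _ => False

/-- Loop-free code is verified by simplifying its precondition. Loops are excluded because their
precondition is `False`, so the value 0 of `Prog.steps` on them does no harm. -/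
theorem Ends.of_wp {p : Prog} {s : State} {T : ℕ} {Q : State → Prop} (hT : p.steps ≤ T)
    (h : p.wp Q s) : Ends p s T Q := by
  suffices H : Ends p s p.steps Q from H.mono hT fun _ _ h => h
  clear hT
  induction p generalizing s Q with
  | skip => exact ⟨_, _, .skip s, le_rfl, h⟩
  | setNat x e => exact ⟨_, _, .setNat x e s, le_rfl, h⟩
  | setReal x e => exact ⟨_, _, .setReal x e s, le_rfl, h⟩
  | storeNat a i e => exact ⟨_, _, .storeNat a i e s, le_rfl, h⟩
  | storeReal a i e => exact ⟨_, _, .storeReal a i e s, le_rfl, h⟩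
  | seq p q hp hq => exact (hp h).seq fun _ _ => hq
  | cond b p q hp hq =>
    exact .cond (fun hb => (hp (h.1 hb)).mono (le_max_left _ _) fun _ _ h => h)
      (fun hb => (hq (h.2 hb)).mono (le_max_right _ _) fun _ _ h => h)
  | loop b p => exact h.elim

/-! ### Reading memory after an assignment. -/

section Access

variable (s : State) (x y a b i v : ℕ) (r : ℝ)

theorem natVar_setNat :
    (s.setNat x v).natVar y = if y = x then v else s.natVar y := by
  simp [State.setNat, Function.update_apply]

theorem realVar_setNat : (s.setNat x v).realVar = s.realVar := rfl

theorem natArr_setNat : (s.setNat x v).natArr = s.natArr := rfl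

theorem realArr_setNat : (s.setNat x v).realArr = s.realArr := rfl

theorem natVar_setReal : (s.setReal x r).natVar = s.natVar := rfl

theorem realVar_setReal :
    (s.setReal x r).realVar y = if y = x then r else s.realVar y := by
  simp [State.setReal, Function.update_apply]

theorem natArr_setReal : (s.setReal x r).natArr = s.natArr := rfl

theorem realArr_setReal : (s.setReal x r).realArr = s.realArr := rfl

theorem natVar_storeNat : (s.storeNat a i v).natVar = s.natVar := rfl

theorem natArr_storeNat : (s.storeNat a i v).natArr b =
    if b = a then Function.update (s.natArr a) i v else s.natArr b := by
  simp [State.storeNat, Function.update_apply]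

theorem realArr_storeNat : (s.storeNat a i v).realArr = s.realArr := rfl

theorem natVar_storeReal : (s.storeReal a i r).natVar = s.natVar := rfl

theorem natArr_storeReal : (s.storeReal a i r).natArr = s.natArr := rfl

theorem realArr_storeReal : (s.storeReal a i r).realArr b =
    if b = a then Function.update (s.realArr a) i r else s.realArr b := by
  simp [State.storeReal, Function.update_apply]

end Access

/-! ## Optimality from prices -/

/-- The extra cost of the `o`-th demand unit at center `i`, continued monotonically beyond `n`. -/
noncomputable def Inst.marginal {n k : ℕ} (I : Inst n k) (i : Fin k) (o : ℕ) : ℝ :=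
  if min o n ≤ I.capacity i then 0 else I.penalty i (min o n - I.capacity i)

theorem Inst.marginal_zero {n k : ℕ} (I : Inst n k) (i : Fin k) : I.marginal i 0 = 0 := by
  simp [Inst.marginal]

theorem Inst.marginal_mono {n k : ℕ} (I : Inst n k) (i : Fin k) : Monotone (I.marginal i) := by
  intro o o' h
  have hm : min o n ≤ min o' n := min_le_min_right _ h
  have hn : min o' n ≤ n := min_le_right _ _
  unfold Inst.marginal
  split_ifs with h₁ h₂ h₂
  · exact le_rfl
  -- The jump from 0 to the first penalty is where positivity enters.
  · exact (I.penalty_pos _ _ (by omega) (by omega)).le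
  · omega
  · exact I.penalty_mono _ _ _ (by omega) (by omega) (by omega)

theorem Inst.sum_penalty {n k : ℕ} (I : Inst n k) (i : Fin k) {o : ℕ} (ho : o ≤ n) :
    ∑ j ∈ Finset.Icc 1 (o - I.capacity i), I.penalty i j =
      ∑ j ∈ Finset.range o, I.marginal i (j + 1) := by
  induction o with
  | zero => simp
  | succ o ih =>
    rw [Finset.sum_range_succ, ← ih (by omega), Inst.marginal, min_eq_left ho]
    split_ifs with h
    · simp [show o + 1 - I.capacity i = 0 by omega, show o - I.capacity i = 0 by omega]
    · rw [show o + 1 - I.capacity i = o - I.capacity i + 1 by omega,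
        Finset.sum_Icc_succ_top (by omega)]

/-- Separates the linear part from the convex part, the form needed for duality. -/
theorem Inst.totalCost_eq {n k : ℕ} (I : Inst n k) (A : Fin n → Fin k) :
    I.totalCost A = ∑ d, I.cost d (A d) +
      ∑ i, ∑ j ∈ Finset.range (occupancy A i), I.marginal i (j + 1) := by
  unfold Inst.totalCost
  rw [Finset.sum_add_distrib]
  congr 1
  · rw [← Finset.sum_fiberwise (s := Finset.univ) (g := A)]
    refine Finset.sum_congr rfl fun i _ => Finset.sum_congr rfl fun d hd => ?_
    rw [(Finset.mem_filter.mp hd).2]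
  · refine Finset.sum_congr rfl fun i _ => I.sum_penalty i ?_
    simpa [occupancy] using Finset.card_le_univ (allotted A i)

theorem sum_price {n k : ℕ} (A : Fin n → Fin k) (y : Fin k → ℝ) :
    ∑ d, y (A d) = ∑ i, occupancy A i * y i := by
  rw [← Finset.sum_fiberwise (s := Finset.univ) (g := A)]
  refine Finset.sum_congr rfl fun i _ => ?_
  rw [Finset.sum_congr rfl fun d hd => by rw [(Finset.mem_filter.mp hd).2]]
  simp [occupancy, allotted]

/-- A monotone marginal cost lies above its supporting line of slope `y` at `o`. -/
theorem sum_marginal_le {δ : ℕ → ℝ} (hδ : Monotone δ) {o : ℕ} {y : ℝ} (hl : δ o ≤ y)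
    (hu : y ≤ δ (o + 1)) (b : ℕ) :
    ∑ j ∈ Finset.range o, δ (j + 1) - o * y ≤ ∑ j ∈ Finset.range b, δ (j + 1) - b * y := by
  have key : ∀ b : ℕ, ∑ j ∈ Finset.range b, δ (j + 1) - b * y =
      ∑ j ∈ Finset.range b, (δ (j + 1) - y) := fun b => by simp
  rw [key, key]
  rcases le_total o b with h | h
  · refine Finset.sum_le_sum_of_subset_of_nonneg (Finset.range_mono h) fun j _ hj => ?_
    have := hδ (show o + 1 ≤ j + 1 by simpa using hj)
    linarith
  · rw [← Finset.sum_range_add_sum_Ico _ h]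
    have : ∑ j ∈ Finset.Ico b o, (δ (j + 1) - y) ≤ 0 :=
      Finset.sum_nonpos fun j hj => by
        have := hδ (show j + 1 ≤ o from (Finset.mem_Ico.mp hj).2)
        linarith
    linarith

/-- An allotment is optimal if there are prices of the centers at which every demand unit is
assigned to a cheapest center and which lie between consecutive marginal penalties. -/
theorem Inst.isOptimal_of_prices {n k : ℕ} (I : Inst n k) (A : Fin n → Fin k) (y : Fin k → ℝ)
    (hA : ∀ d i, I.cost d (A d) + y (A d) ≤ I.cost d i + y i)
    (hl : ∀ i, I.marginal i (occupancy A i) ≤ y i)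
    (hu : ∀ i, y i ≤ I.marginal i (occupancy A i + 1)) : I.IsOptimal A := by
  intro B
  have h₁ : ∑ d, (I.cost d (A d) + y (A d)) ≤ ∑ d, (I.cost d (B d) + y (B d)) :=
    Finset.sum_le_sum fun d _ => hA d (B d)
  have h₂ := Finset.sum_le_sum fun i (_ : i ∈ Finset.univ) =>
    sum_marginal_le (I.marginal_mono i) (hl i) (hu i) (occupancy B i)
  -- Both inequalities now contain the sums of occupancy times price, which cancel when they are
  -- added.
  rw [Finset.sum_add_distrib, Finset.sum_add_distrib, sum_price, sum_price] at h₁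
  rw [Finset.sum_sub_distrib, Finset.sum_sub_distrib] at h₂
  rw [I.totalCost_eq, I.totalCost_eq]
  linarith

/-! ## Tournament trees -/

/-- The better of two candidates, where `0` stands for no candidate and `d + 1` for `d`. -/
noncomputable def pick (key : ℕ → ℝ) (a b : ℕ) : ℕ :=
  if a = 0 then b else if b = 0 then a else if key (b - 1) < key (a - 1) then b else a

theorem pick_eq_or (key : ℕ → ℝ) (a b : ℕ) : pick key a b = a ∨ pick key a b = b := by
  unfold pick
  split_ifs <;> simp

theorem pick_left {key : ℕ → ℝ} {a : ℕ} (b : ℕ) (ha : a ≠ 0) :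
    pick key a b ≠ 0 ∧ key (pick key a b - 1) ≤ key (a - 1) := by
  unfold pick
  rw [if_neg ha]
  split_ifs with h₁ h₂
  · exact ⟨ha, le_rfl⟩
  · exact ⟨h₁, h₂.le⟩
  · exact ⟨ha, le_rfl⟩

theorem pick_right {key : ℕ → ℝ} (a : ℕ) {b : ℕ} (hb : b ≠ 0) :
    pick key a b ≠ 0 ∧ key (pick key a b - 1) ≤ key (b - 1) := by
  unfold pick
  split_ifs with h₁ h₂
  · exact ⟨hb, le_rfl⟩
  · exact ⟨hb, le_rfl⟩
  · exact ⟨h₁, not_lt.mp h₂⟩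

/-- `val` holds a tournament tree for the `d < n` with `a d = i`: node `v` has the children `2 * v`
and `2 * v + 1`, and the leaves are `n, …, 2 * n - 1`. Node `u` may hold a wrong winner. -/
structure IsTournament (n : ℕ) (key : ℕ → ℝ) (a : ℕ → ℕ) (i : ℕ) (val : ℕ → ℕ) (u : ℕ) :
    Prop where
  leaf : ∀ d < n, val (n + d) = if a d = i then d + 1 else 0
  node : ∀ v, 1 ≤ v → v < n → v ≠ u → val v = pick key (val (2 * v)) (val (2 * v + 1))

namespace IsTournament

variable {n i u : ℕ} {key : ℕ → ℝ} {a val : ℕ → ℕ}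

/-- Soundness of the recorded winners, by induction from the leaves upwards. No assumption that `n`
is a power of two is needed: every child of a node below `n` lies below `2 * n`. -/
theorem mem (h : IsTournament n key a i val 0) {v : ℕ} (hv : 1 ≤ v) (hv' : v < 2 * n) :
    val v = 0 ∨ ∃ d < n, val v = d + 1 ∧ a d = i := by
  induction hm : 2 * n - v using Nat.strong_induction_on generalizing v with
  | _ m ih =>
    by_cases hn : v < n
    · rw [h.node v hv hn (by omega)]
      rcases pick_eq_or key (val (2 * v)) (val (2 * v + 1)) with h' | h' <;> rw [h']
      · exact ih (2 * n - 2 * v) (by omega) (by omega) (by omega) rfl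
      · exact ih (2 * n - (2 * v + 1)) (by omega) (by omega) (by omega) rfl
    · obtain ⟨d, rfl⟩ := Nat.exists_eq_add_of_le (not_lt.mp hn)
      rw [h.leaf d (by omega)]
      split_ifs with hd
      · exact .inr ⟨d, by omega, rfl, hd⟩
      · exact .inl rfl

/-- Passing from a node to its parent never increases the key, and repeated halving reaches node 1.
-/
theorem root_le (h : IsTournament n key a i val 0) {v : ℕ} (hv : 1 ≤ v) (hv' : v < 2 * n)
    (h0 : val v ≠ 0) : val 1 ≠ 0 ∧ key (val 1 - 1) ≤ key (val v - 1) := by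
  induction v using Nat.strong_induction_on with
  | _ v ih =>
    by_cases h1 : v = 1
    · subst h1
      exact ⟨h0, le_rfl⟩
    · have hp := h.node (v / 2) (by omega) (by omega) (by omega)
      have hle : val (v / 2) ≠ 0 ∧ key (val (v / 2) - 1) ≤ key (val v - 1) := by
        rw [hp]
        rcases Nat.even_or_odd' v with ⟨w, hw | hw⟩
        · rw [show 2 * (v / 2) = v by omega]
          exact pick_left _ h0
        · rw [show 2 * (v / 2) + 1 = v by omega]
          exact pick_right _ h0
      obtain ⟨h₁, h₂⟩ := ih (v / 2) (by omega) (by omega) (by omega) hle.1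
      exact ⟨h₁, h₂.trans hle.2⟩

theorem root (h : IsTournament n key a i val 0) (hn : 0 < n) :
    (val 1 = 0 ∧ ∀ d < n, a d ≠ i) ∨
      ∃ d < n, val 1 = d + 1 ∧ a d = i ∧ ∀ d' < n, a d' = i → key d ≤ key d' := by
  have hle : ∀ d < n, a d = i → val 1 ≠ 0 ∧ key (val 1 - 1) ≤ key d := fun d hd hi => by
    have := h.leaf d hd
    rw [if_pos hi] at this
    simpa [this] using h.root_le (v := n + d) (by omega) (by omega) (by omega)
  rcases h.mem le_rfl (by omega) with h0 | ⟨d, hd, h1, hi⟩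
  · exact .inl ⟨h0, fun d hd hi => (hle d hd hi).1 h0⟩
  · exact .inr ⟨d, hd, h1, hi, fun d' hd' hi' => by simpa [h1] using (hle d' hd' hi').2⟩

/-- Changing a leaf can invalidate only its parent. For `n = 1` the leaf is the root and the
exceptional node is 0, that is, none. -/
theorem update_leaf (h : IsTournament n key a i val 0) (e v : ℕ) :
    IsTournament n key (Function.update a e v) i
      (Function.update val (n + e) (if v = i then e + 1 else 0)) ((n + e) / 2) := by
  refine ⟨fun d hd => ?_, fun w hw hw' hne => ?_⟩
  · by_cases hde : d = e
    · simp [hde]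
    · rw [Function.update_of_ne (by omega), Function.update_of_ne hde, h.leaf d hd]
  · rw [Function.update_of_ne (by omega), Function.update_of_ne (by omega),
      Function.update_of_ne (by omega), h.node w hw hw' (by omega)]

/-- Replaying one match moves the only possible defect to the parent, and once it reaches node 0 the
tree is correct. -/
theorem update_node (h : IsTournament n key a i val u) (hu : u < n) :
    IsTournament n key a i
      (Function.update val u (pick key (val (2 * u)) (val (2 * u + 1)))) (u / 2) := by
  refine ⟨fun d hd => ?_, fun w hw hw' hne => ?_⟩
  · rw [Function.update_of_ne (by omega), h.leaf d hd]
  · rw [Function.update_of_ne (a := 2 * w) (by omega),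
      Function.update_of_ne (a := 2 * w + 1) (by omega)]
    by_cases hwu : w = u
    · simp [hwu]
    · rw [Function.update_of_ne hwu, h.node w hw hw' hwu]

theorem congr {a' val' : ℕ → ℕ} (h : IsTournament n key a i val u)
    (ha : ∀ d < n, (a d = i ↔ a' d = i)) (hval : ∀ v < 2 * n, val' v = val v) :
    IsTournament n key a' i val' u := by
  refine ⟨fun d hd => ?_, fun v hv hv' hne => ?_⟩
  · rw [hval _ (by omega), h.leaf d hd]
    simp only [ha d hd]
  · rw [hval _ (by omega), hval _ (by omega), hval _ (by omega), h.node v hv hv' hne]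

end IsTournament

/-! ## Counting -/

/-- The number of `d < n` with `a d = i`. -/
def count (n : ℕ) (a : ℕ → ℕ) (i : ℕ) : ℕ :=
  ((Finset.range n).filter fun d => a d = i).card

/-- The additive form avoids truncated subtraction and covers `a e = v`; it is also exactly the form
in which `Augmenting.count` is preserved. -/
theorem count_update {n : ℕ} (a : ℕ → ℕ) {e : ℕ} (he : e < n) (v i : ℕ) :
    count n (Function.update a e v) i + (if a e = i then 1 else 0) =
      count n a i + if v = i then 1 else 0 := by
  have he' : e ∈ Finset.range n := Finset.mem_range.mpr he
  unfold count
  rw [Finset.card_filter, Finset.card_filter, ← Finset.add_sum_erase _ _ he',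
    ← Finset.add_sum_erase (Finset.range n) (fun d => if a d = i then 1 else 0) he',
    Finset.sum_congr rfl fun d hd => by rw [Function.update_of_ne (Finset.ne_of_mem_erase hd)]]
  simp only [Function.update_self]
  omega

/-! ## Shortest augmenting paths -/

/-- At the prices `y`, no center is cheaper for `d` than `i`. -/
def Prefers (k : ℕ) (C : ℕ → ℕ → ℝ) (y : ℕ → ℝ) (d i : ℕ) : Prop :=
  ∀ j < k, C d i + y i ≤ C d j + y j

/-- An intermediate stage of Dijkstra's algorithm for the insertion of the demand unit `m`.
`D j` is the length of a shortest path to `j` so far, `done j` is the round in which it was found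
to be final (`0` if it was not), and `dem j` is the demand unit moved to `j` on that path. -/
structure Searching (k : ℕ) (C : ℕ → ℕ → ℝ) (a : ℕ → ℕ) (y : ℕ → ℝ) (m : ℕ) (D : ℕ → ℝ)
    (done dem : ℕ → ℕ) : Prop where
  le_direct : ∀ j < k, D j ≤ C m j
  order : ∀ i < k, ∀ j < k, done i ≠ 0 → (done j = 0 ∨ done i ≤ done j) → D i + y i ≤ D j + y j
  relaxed : ∀ i < k, done i ≠ 0 → ∀ d < m, a d = i → ∀ j < k, D j ≤ D i + (C d j - C d i)
  parent : ∀ j < k, (dem j = m ∧ D j = C m j) ∨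
    (dem j < m ∧ a (dem j) < k ∧ done (a (dem j)) ≠ 0 ∧ (done j = 0 ∨ done (a (dem j)) < done j) ∧
      D j = D (a (dem j)) + (C (dem j) j - C (dem j) (a (dem j))))

/-- Relaxation of the edge from `b` to `j` in the round in which `b` becomes final. -/
def Relaxed (C : ℕ → ℕ → ℝ) (a : ℕ → ℕ) (m b : ℕ) (D D' : ℕ → ℝ) (done dem dem' : ℕ → ℕ)
    (j : ℕ) : Prop :=
  (D' j = D j ∧ dem' j = dem j ∧
    (done j = 0 → ∀ d < m, a d = b → D j ≤ D b + (C d j - C d b))) ∨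
  (done j = 0 ∧ dem' j < m ∧ a (dem' j) = b ∧ D' j = D b + (C (dem' j) j - C (dem' j) b) ∧
    D' j ≤ D j ∧ ∀ d < m, a d = b → D' j ≤ D b + (C d j - C d b))

theorem Searching.init (k : ℕ) (C : ℕ → ℕ → ℝ) (a : ℕ → ℕ) (y : ℕ → ℝ) (m : ℕ) {D : ℕ → ℝ}
    {done dem : ℕ → ℕ} (hD : ∀ j < k, D j = C m j) (hdone : ∀ j < k, done j = 0)
    (hdem : ∀ j < k, dem j = m) : Searching k C a y m D done dem where
  le_direct j hj := (hD j hj).le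
  order i hi _ _ h := (h (hdone i hi)).elim
  relaxed i hi h := (h (hdone i hi)).elim
  parent j hj := .inl ⟨hdem j hj, hD j hj⟩

/-- `Prefers` says that reduced edge lengths are nonnegative. Hence a path through `b`, which has
the least reduced distance among the non-final centers, cannot bring another center below `D b + y
b`, and final centers need no further relaxation. -/
theorem Searching.step {k : ℕ} {C : ℕ → ℕ → ℝ} {a : ℕ → ℕ} {y : ℕ → ℝ} {m : ℕ} {D D' : ℕ → ℝ}
    {done dem dem' : ℕ → ℕ} {r b : ℕ} (h : Searching k C a y m D done dem)
    (hpref : ∀ d < m, Prefers k C y d (a d)) (hr : ∀ i < k, done i ≤ r) (hb : b < k)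
    (hb0 : done b = 0) (hmin : ∀ j < k, done j = 0 → D b + y b ≤ D j + y j)
    (hrel : ∀ j < k, Relaxed C a m b D D' (Function.update done b (r + 1)) dem dem' j) :
    Searching k C a y m D' (Function.update done b (r + 1)) dem' := by
  have hle : ∀ j < k, D' j ≤ D j := fun j hj => by
    rcases hrel j hj with h' | h'
    · exact h'.1.le
    · exact h'.2.2.2.2.1
  have heq : ∀ j < k, Function.update done b (r + 1) j ≠ 0 → D' j = D j := fun j hj h0 => by
    rcases hrel j hj with h' | h'
    · exact h'.1
    · exact (h0 h'.1).elim
  have hb' : Function.update done b (r + 1) b = r + 1 := Function.update_self ..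
  have hne : ∀ j, j ≠ b → Function.update done b (r + 1) j = done j :=
    fun j hj => Function.update_of_ne hj _ _
  have hDb : D' b = D b := heq b hb (by simp)
  have hbmin : ∀ j < k, Function.update done b (r + 1) j = 0 → D b + y b ≤ D' j + y j := by
    intro j hj h0
    have hjb : j ≠ b := fun h => by simp [h] at h0
    rcases hrel j hj with h' | ⟨-, hm, ha, hD, -⟩
    · rw [h'.1]
      exact hmin j hj (by rwa [hne j hjb] at h0)
    · have := hpref _ hm j hj
      rw [ha] at this
      linarith
  have hbmax : ∀ j < k, Function.update done b (r + 1) j ≠ 0 → D j + y j ≤ D b + y b := by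
    intro j hj h0
    by_cases hjb : j = b
    · rw [hjb]
    · rw [hne j hjb] at h0
      exact h.order j hj b hb h0 (.inl hb0)
  refine ⟨fun j hj => (hle j hj).trans (h.le_direct j hj), ?_, ?_, ?_⟩
  · intro i hi j hj hi0 hij
    rw [heq i hi hi0]
    by_cases hj0 : Function.update done b (r + 1) j = 0
    · exact (hbmax i hi hi0).trans (hbmin j hj hj0)
    · rw [heq j hj hj0]
      replace hij := hij.resolve_left hj0
      by_cases hjb : j = b
      · rw [hjb]
        exact hbmax i hi hi0
      -- The round `r + 1` of `b` is later than that of every center final before.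
      · have hib : i ≠ b := by
          rintro rfl
          rw [hb', hne j hjb] at hij
          have := hr j hj
          omega
        rw [hne i hib] at hi0 hij
        rw [hne j hjb] at hij
        exact h.order i hi j hj hi0 (.inr hij)
  · intro i hi hi0 d hd had j hj
    rw [heq i hi hi0]
    by_cases hib : i = b
    · subst hib
      by_cases hj0 : Function.update done i (r + 1) j = 0
      · rcases hrel j hj with h' | h'
        · rw [h'.1]
          exact h'.2.2 hj0 d hd had
        · exact h'.2.2.2.2.2 d hd had
      · rw [heq j hj hj0]
        -- A final center is no farther than `b` in reduced distance, and the edge from `b` has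
        -- nonnegative reduced length, so the inequality holds without an update.
        have h₁ := hbmax j hj hj0
        have h₂ := hpref d hd j hj
        rw [had] at h₂
        linarith
    · rw [hne i hib] at hi0
      exact (hle j hj).trans (h.relaxed i hi hi0 d hd had j hj)
  · intro j hj
    rcases hrel j hj with ⟨hD, hdem, -⟩ | ⟨h0, hm, ha, hD, -⟩
    · rw [hD, hdem]
      refine (h.parent j hj).imp_right fun ⟨h₁, h₂, h₃, h₄, h₅⟩ => ?_
      have hpb : a (dem j) ≠ b := fun h => h₃ (h ▸ hb0)
      have h₃' : Function.update done b (r + 1) (a (dem j)) ≠ 0 := by rwa [hne _ hpb]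
      refine ⟨h₁, h₂, h₃', ?_, by rwa [heq _ h₂ h₃']⟩
      rw [hne _ hpb]
      by_cases hjb : j = b
      · subst hjb
        have := hr _ h₂
        rw [hb']
        omega
      · rwa [hne j hjb]
    · refine .inr ⟨hm, ha ▸ hb, by simp [ha], .inl h0, ?_⟩
      rw [ha, hDb, hD]

/-- The new prices after a complete search. -/
theorem Searching.finish {k : ℕ} {C : ℕ → ℕ → ℝ} {a : ℕ → ℕ} {y : ℕ → ℝ} {m : ℕ} {D : ℕ → ℝ}
    {done dem : ℕ → ℕ} {δ : ℕ → ℕ → ℝ} {occ : ℕ → ℕ} {t : ℕ} {L : ℝ} {y' : ℕ → ℝ}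
    (h : Searching k C a y m D done dem) (ha : ∀ d < m, a d < k)
    (hpref : ∀ d < m, Prefers k C y d (a d)) (hdone : ∀ i < k, done i ≠ 0)
    (hl : ∀ i < k, δ i (occ i) ≤ y i) (hu : ∀ i < k, y i ≤ δ i (occ i + 1)) (ht : t < k)
    (hL : L = D t + δ t (occ t + 1)) (hmin : ∀ i < k, L ≤ D i + δ i (occ i + 1))
    (hy' : ∀ i < k, y' i = max (y i) (L - D i)) :
    (∀ d < m, Prefers k C y' d (a d)) ∧ (∀ i < k, δ i (occ i) ≤ y' i) ∧
      (∀ i < k, y' i ≤ δ i (occ i + 1)) ∧ y' t = δ t (occ t + 1) ∧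
      ∀ u < k, done u ≤ done t → Prefers k C y' (dem u) u := by
  have hge : ∀ i < k, L - D i ≤ y' i := fun i hi => hy' i hi ▸ le_max_right _ _
  have h₁ : ∀ d < m, Prefers k C y' d (a d) := by
    intro d hd j hj
    have h₁ := h.relaxed _ (ha d hd) (hdone _ (ha d hd)) d hd rfl j hj
    have h₂ := hpref d hd j hj
    rw [hy' j hj, hy' _ (ha d hd)]
    have h₃ := le_max_left (y j) (L - D j)
    have h₄ := le_max_right (y j) (L - D j)
    -- If the old price survives at `a d`, the old preference suffices because prices only rise. If
    -- the price is `L - D (a d)`, the edge inequality `h₁` gives the claim.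
    rcases max_choice (y (a d)) (L - D (a d)) with h' | h' <;> rw [h'] <;> linarith
  -- For centers final no later than `t`, `D u + y u ≤ D t + y t ≤ L`, so the second term of the
  -- maximum wins and the new price is exactly `L - D u`.
  have hpath : ∀ u < k, done u ≤ done t → y' u = L - D u := fun u hu' hut => by
    have := h.order u hu' t ht (hdone u hu') (.inr hut)
    have := hu t ht
    rw [hy' u hu', max_eq_right]
    linarith
  refine ⟨h₁, fun i hi => (hl i hi).trans (hy' i hi ▸ le_max_left _ _), fun i hi => ?_, ?_, ?_⟩
  · rw [hy' i hi]
    have := hmin i hi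
    exact max_le (hu i hi) (by linarith)
  · rw [hpath t ht le_rfl, hL]
    ring
  · intro u hu' hut j hj
    rcases h.parent u hu' with ⟨hm, hD⟩ | ⟨hm, hk, -, hlt, hD⟩
    · have := h.le_direct j hj
      have := hge j hj
      rw [hpath u hu' hut, hm]
      linarith
    -- The edge into `u` is tight: at the new prices `dem u` is indifferent between its present
    -- center and `u`, so it prefers `u` as well.
    · have hlt' := hlt.resolve_left (hdone u hu')
      have h₂ := h₁ _ hm j hj
      rw [hpath _ hk (by omega)] at h₂
      rw [hpath u hu' hut]
      linarith

/-! ## The algorithm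

Demand units are inserted one by one. Each insertion runs Dijkstra's algorithm on the centers and
moves demand units along a shortest augmenting path. For each pair of centers `i`, `j` a tournament
tree provides a demand unit at `i` that is cheapest to move to `j`.

Besides the input, the memory is used as follows.
* variables: `2` loop bound, `3` accumulator, `4` inserted demand unit, `5` round, `6` center `j`,
  `7` selected center, `8` end of the remaining path, `9` moved demand unit, `10` center whose
  trees are updated, `11` node, `12` address of the tree, `13`, `14` children, `15` next center;
* real variables: `0` length of a path, `1` the same with the penalty;
* arrays: `1` allotment (`k` for demand units not yet inserted), `2` multiples of `k`,
  `4` multiples of `2 * n`, `5` trees, `6` occupancies, `7` rounds, `8` demand units on paths;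
* real arrays: `2` prices, `3` distances. -/

/-- The cost difference for the candidate in the variable `x`. -/
def RealExpr.key (x : ℕ) : RealExpr :=
  .sub (.arr 0 (.add (.arr 2 (.sub (.var x) (.const 1))) (.var 6)))
    (.arr 0 (.add (.arr 2 (.sub (.var x) (.const 1))) (.var 10)))

namespace Prog

/-- Fill the array `a` with an arithmetic progression. -/
def table (a : ℕ) (start step bound : NatExpr) : Prog :=
  .seq (.setNat 3 start) (.seq (.setNat 2 bound)
    (.forLoop 6 2 (.seq (.storeNat a (.var 6) (.var 3)) (.setNat 3 (.add (.var 3) step)))))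

/-- Multiplication is unavailable, so the multiples used for addressing are tabulated by repeated
addition. The length `n + k + 1` covers demand units and centers as indices, and also the index `k`,
where `k * k` is read off. -/
def init : Prog :=
  .seq (.table 2 (.const 0) (.var 1) (.add (.add (.var 0) (.var 1)) (.const 1)))
  (.seq (.table 4 (.const 0) (.add (.var 0) (.var 0)) (.add (.arr 2 (.var 1)) (.const 1)))
  (.seq (.table 5 (.const 0) (.const 0) (.arr 4 (.arr 2 (.var 1))))
  (.seq (.table 1 (.var 1) (.const 0) (.var 0))
  (.seq (.table 6 (.const 0) (.const 0) (.var 1))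
    (.forLoop 6 1 (.storeReal 2 (.var 6) .zero))))))

def startSearch : Prog :=
  .forLoop 6 1 (.seq (.storeReal 3 (.var 6) (.arr 0 (.add (.arr 2 (.var 4)) (.var 6))))
    (.seq (.storeNat 7 (.var 6) (.const 0)) (.storeNat 8 (.var 6) (.var 4))))

/-- Select a center of minimal reduced distance among those that are not final. -/
def select : Prog :=
  .seq (.setNat 7 (.var 1))
    (.forLoop 6 1 (.cond
      (.conj (.natEq (.arr 7 (.var 6)) (.const 0))
        (.neg (.conj (.neg (.natEq (.var 7) (.var 1)))
          (.neg (.realLt (.add (.arr 3 (.var 6)) (.arr 2 (.var 6)))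
            (.add (.arr 3 (.var 7)) (.arr 2 (.var 7))))))))
      (.setNat 7 (.var 6)) .skip))

/-- Relax the edges from the selected center. -/
def relax : Prog :=
  .forLoop 6 1
    (.seq (.setNat 9 (.arr 5 (.add (.arr 4 (.add (.arr 2 (.var 7)) (.var 6))) (.const 1))))
    (.seq (.setReal 0 (.add (.arr 3 (.var 7))
      (.sub (.arr 0 (.add (.arr 2 (.sub (.var 9) (.const 1))) (.var 6)))
        (.arr 0 (.add (.arr 2 (.sub (.var 9) (.const 1))) (.var 7))))))
    (.cond (.conj (.natEq (.arr 7 (.var 6)) (.const 0))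
        (.conj (.neg (.natEq (.var 9) (.const 0))) (.realLt (.var 0) (.arr 3 (.var 6)))))
      (.seq (.storeReal 3 (.var 6) (.var 0)) (.storeNat 8 (.var 6) (.sub (.var 9) (.const 1))))
      .skip)))

def round : Prog :=
  .seq .select (.seq (.storeNat 7 (.var 7) (.add (.var 5) (.const 1))) .relax)

def search : Prog :=
  .seq .startSearch (.forLoop 5 1 .round)

/-- Find the best last center of a path. -/
def chooseTarget : Prog :=
  .seq (.setNat 7 (.var 1))
    (.forLoop 6 1
      (.seq (.cond (.natLt (.arr 6 (.var 6)) (.arr 0 (.var 6)))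
        (.setReal 1 (.arr 3 (.var 6)))
        (.setReal 1 (.add (.arr 3 (.var 6)) (.arr 1 (.add (.half (.arr 4 (.var 6)))
          (.sub (.arr 6 (.var 6)) (.arr 0 (.var 6))))))))
      (.cond (.neg (.conj (.neg (.natEq (.var 7) (.var 1))) (.neg (.realLt (.var 1) (.var 0)))))
        (.seq (.setNat 7 (.var 6)) (.setReal 0 (.var 1))) .skip)))

def updatePrices : Prog :=
  .forLoop 6 1 (.cond (.realLt (.arr 2 (.var 6)) (.sub (.var 0) (.arr 3 (.var 6))))
    (.storeReal 2 (.var 6) (.sub (.var 0) (.arr 3 (.var 6)))) .skip)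

/-- Replay the match at the parent of a node. -/
def climbStep : Prog :=
  .seq (.setNat 11 (.half (.var 11)))
  (.seq (.setNat 13 (.arr 5 (.add (.var 12) (.add (.var 11) (.var 11)))))
  (.seq (.setNat 14 (.arr 5 (.add (.var 12) (.add (.add (.var 11) (.var 11)) (.const 1)))))
  (.cond (.conj (.neg (.natEq (.var 13) (.const 0))) (.neg (.conj (.neg (.natEq (.var 14) (.const 0)))
      (.realLt (.key 14) (.key 13)))))
    (.storeNat 5 (.add (.var 12) (.var 11)) (.var 13))
    (.storeNat 5 (.add (.var 12) (.var 11)) (.var 14)))))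

def climb : Prog :=
  .loop (.natLt (.const 1) (.var 11)) .climbStep

/-- Update the leaf of a demand unit in a tournament tree. -/
def setLeaf : Prog :=
  .seq (.setNat 12 (.arr 4 (.add (.arr 2 (.var 10)) (.var 6))))
  (.seq (.setNat 11 (.add (.var 0) (.var 9)))
  (.cond (.natEq (.arr 1 (.var 9)) (.var 10))
    (.storeNat 5 (.add (.var 12) (.var 11)) (.add (.var 9) (.const 1)))
    (.storeNat 5 (.add (.var 12) (.var 11)) (.const 0))))

/-- Update all trees of one center for one demand unit. -/
def updateRow : Prog :=
  .forLoop 6 1 (.seq .setLeaf .climb)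

def walkStep : Prog :=
  .seq (.seq (.setNat 9 (.arr 8 (.var 8)))
    (.seq (.setNat 15 (.arr 1 (.var 9))) (.storeNat 1 (.var 9) (.var 8))))
  (.seq (.cond (.natLt (.var 15) (.var 1)) (.seq (.setNat 10 (.var 15)) .updateRow) .skip)
  (.seq (.seq (.setNat 10 (.var 8)) .updateRow) (.setNat 8 (.var 15))))

/-- Move demand units along the path that was found. -/
def walk : Prog :=
  .loop (.natLt (.var 8) (.var 1)) .walkStep

def insert : Prog :=
  .seq .search (.seq .chooseTarget (.seq .updatePrices
    (.seq (.seq (.storeNat 6 (.var 7) (.add (.arr 6 (.var 7)) (.const 1))) (.setNat 8 (.var 7)))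
      .walk)))

def distribute : Prog :=
  .seq .init (.forLoop 4 0 .insert)

end Prog

/-- The memory contents that do not change after the initialization. -/
structure Data where
  n : ℕ
  k : ℕ
  cap : ℕ → ℕ
  mulK : ℕ → ℕ
  base : ℕ → ℕ
  cost : ℕ → ℝ
  pen : ℕ → ℝ

namespace Data

variable (𝒟 : Data)

structure Valid : Prop where
  n_pos : 0 < 𝒟.n
  k_pos : 0 < 𝒟.k
  mulK : ∀ x ≤ 𝒟.n + 𝒟.k, 𝒟.mulK x = x * 𝒟.k
  base : ∀ x ≤ 𝒟.k * 𝒟.k, 𝒟.base x = x * (2 * 𝒟.n)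

structure Holds (s : State) : Prop where
  n : s.natVar 0 = 𝒟.n
  k : s.natVar 1 = 𝒟.k
  cap : s.natArr 0 = 𝒟.cap
  mulK : s.natArr 2 = 𝒟.mulK
  base : s.natArr 4 = 𝒟.base
  cost : s.realArr 0 = 𝒟.cost
  pen : s.realArr 1 = 𝒟.pen

/-- The cost of assigning demand unit `d` to center `i`. -/
def C (d i : ℕ) : ℝ := 𝒟.cost (d * 𝒟.k + i)

/-- The cost of moving demand unit `d` from center `i` to center `j`. -/
def key (i j d : ℕ) : ℝ := 𝒟.cost (𝒟.mulK d + j) - 𝒟.cost (𝒟.mulK d + i)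

/-- The array `tr` contains the tournament trees of the center `i`. -/
def Row (a tr : ℕ → ℕ) (i : ℕ) : Prop :=
  ∀ j < 𝒟.k, IsTournament 𝒟.n (𝒟.key i j) a i (fun v => tr ((i * 𝒟.k + j) * (2 * 𝒟.n) + v)) 0

variable {𝒟}

theorem Valid.key_eq (h : 𝒟.Valid) {i j d : ℕ} (hd : d < 𝒟.n) :
    𝒟.key i j d = 𝒟.C d j - 𝒟.C d i := by
  unfold key C
  rw [h.mulK d (by omega)]

theorem Valid.base_eq (h : 𝒟.Valid) {i j : ℕ} (hi : i < 𝒟.k) (hj : j < 𝒟.k) :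
    𝒟.base (𝒟.mulK i + j) = (i * 𝒟.k + j) * (2 * 𝒟.n) := by
  rw [h.mulK i (by omega), h.base]
  have : (i + 1) * 𝒟.k ≤ 𝒟.k * 𝒟.k := Nat.mul_le_mul_right _ hi
  rw [Nat.add_mul] at this
  omega

theorem Holds.frame {p : Prog} {s s' : State} (h : 𝒟.Holds s) (hf : p.Frame s s')
    (hn : 0 ∉ p.natVars) (hk : 1 ∉ p.natVars) (hcap : 0 ∉ p.natArrs) (hmulK : 2 ∉ p.natArrs)
    (hbase : 4 ∉ p.natArrs) (hcost : 0 ∉ p.realArrs) (hpen : 1 ∉ p.realArrs) : 𝒟.Holds s' :=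
  ⟨(hf.natVar _ hn).trans h.n, (hf.natVar _ hk).trans h.k, (hf.natArr _ hcap).trans h.cap,
    (hf.natArr _ hmulK).trans h.mulK, (hf.natArr _ hbase).trans h.base,
    (hf.realArr _ hcost).trans h.cost, (hf.realArr _ hpen).trans h.pen⟩

end Data

variable {𝒟 : Data}

/-! ### Tournament trees in memory -/

theorem climbStep_ends {s : State} (h : 𝒟.Holds s) :
    Ends .climbStep s 70 fun s' => s'.natVar 11 = s.natVar 11 / 2 ∧
      s'.natArr 5 = Function.update (s.natArr 5) (s.natVar 12 + s.natVar 11 / 2)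
        (pick (𝒟.key (s.natVar 10) (s.natVar 6))
          (s.natArr 5 (s.natVar 12 + 2 * (s.natVar 11 / 2)))
          (s.natArr 5 (s.natVar 12 + (2 * (s.natVar 11 / 2) + 1)))) := by
  refine Ends.of_wp (by decide) ?_
  simp only [Prog.climbStep, Prog.wp, NatExpr.eval, Test.Holds, RealExpr.key, RealExpr.eval,
    natVar_setNat, natArr_setNat, realArr_setNat, natArr_storeNat, natVar_storeNat, h.cost, h.mulK,
    ← two_mul]
  norm_num
  constructor
  · intro h₁ h₂
    congr 1
    unfold pick Data.key
    rw [if_neg h₁]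
    split_ifs with h₃ h₄
    · rfl
    · exact absurd h₄ (not_lt.mpr (by linarith [h₂ h₃]))
    · rfl
  · intro h₁
    congr 1
    unfold pick Data.key
    split_ifs with h₂ h₃ h₄
    · rfl
    · exact absurd h₃ (h₁ h₂).1
    · rfl
    · exact absurd (by linarith [(h₁ h₂).2]) h₄

/-- The possible defect is always the parent of the current node. Halving lowers the binary
logarithm of the node number, and at node 1 the parent is 0, so no defect remains. The 74 is 70 for
the body plus 4 for the test and the loop step. -/
theorem climb_ends {s : State} {a : ℕ → ℕ} (h : 𝒟.Holds s) (h1 : 1 ≤ s.natVar 11)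
    (hn : s.natVar 11 < 2 * 𝒟.n)
    (ht : IsTournament 𝒟.n (𝒟.key (s.natVar 10) (s.natVar 6)) a (s.natVar 10)
      (fun v => s.natArr 5 (s.natVar 12 + v)) (s.natVar 11 / 2)) :
    Ends .climb s (Nat.log 2 (2 * 𝒟.n) * 74 + 4) fun s' =>
      IsTournament 𝒟.n (𝒟.key (s.natVar 10) (s.natVar 6)) a (s.natVar 10)
        (fun v => s'.natArr 5 (s.natVar 12 + v)) 0 ∧
      ∀ x, (∀ v < 2 * 𝒟.n, x ≠ s.natVar 12 + v) → s'.natArr 5 x = s.natArr 5 x := by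
  refine (Ends.loop (T := 70) (fun s' => Prog.climb.Frame s s' ∧ 1 ≤ s'.natVar 11 ∧
    s'.natVar 11 < 2 * 𝒟.n ∧
    IsTournament 𝒟.n (𝒟.key (s.natVar 10) (s.natVar 6)) a (s.natVar 10)
        (fun v => s'.natArr 5 (s.natVar 12 + v)) (s'.natVar 11 / 2) ∧
      ∀ x, (∀ v < 2 * 𝒟.n, x ≠ s.natVar 12 + v) → s'.natArr 5 x = s.natArr 5 x)
    (fun s' => Nat.log 2 (s'.natVar 11)) ?_
    ⟨.refl _ _, h1, hn, ht, fun _ _ => rfl⟩).mono ?_ ?_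
  · rintro s' ⟨hf, -, hn', ht', hx⟩ hb
    simp only [Test.Holds, NatExpr.eval] at hb
    have h' := h.frame hf (by decide) (by decide) (by decide) (by decide) (by decide) (by decide)
      (by decide)
    refine (climbStep_ends h').imp ?_
    rintro s'' hf' ⟨h₁, h₂⟩
    have e12 := hf.natVar 12 (by decide)
    rw [hf.natVar 12 (by decide), hf.natVar 10 (by decide), hf.natVar 6 (by decide)] at h₂
    refine ⟨⟨hf.trans hf'.loop, by omega, by omega, ?_, fun x hx' => ?_⟩, ?_⟩
    · have := ht'.update_node (by omega)
      rw [h₁]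
      convert this using 1
      funext v
      rw [h₂]
      simp only [Function.update_apply]
      by_cases hv : v = s'.natVar 11 / 2
      · simp [hv]
      · rw [if_neg (by omega), if_neg hv]
    · rw [h₂, Function.update_of_ne (hx' _ (by omega)), hx x hx']
    · have : 1 ≤ Nat.log 2 (s'.natVar 11) := Nat.log_pos (by norm_num) (by omega)
      rw [h₁, Nat.log_div_base]
      omega
  · have : Nat.log 2 (s.natVar 11) ≤ Nat.log 2 (2 * 𝒟.n) := Nat.log_mono_right hn.le
    simp only [Test.steps, NatExpr.steps]
    omega
  · rintro s' - ⟨⟨hf, h1', -, ht', hx⟩, hb⟩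
    simp only [Test.Holds, NatExpr.eval] at hb
    have : s'.natVar 11 / 2 = 0 := by omega
    exact ⟨this ▸ ht', hx⟩

theorem setLeaf_ends {s : State} (h : 𝒟.Holds s) :
    Ends .setLeaf s 40 fun s' => s'.natVar 11 = 𝒟.n + s.natVar 9 ∧
      s'.natVar 12 = 𝒟.base (𝒟.mulK (s.natVar 10) + s.natVar 6) ∧
      s'.natArr 5 = Function.update (s.natArr 5) (s'.natVar 12 + s'.natVar 11)
        (if s.natArr 1 (s.natVar 9) = s.natVar 10 then s.natVar 9 + 1 else 0) := by
  refine Ends.of_wp (by decide) ?_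
  simp only [Prog.setLeaf, Prog.wp, NatExpr.eval, Test.Holds,
    natVar_setNat, natArr_setNat, natArr_storeNat, natVar_storeNat, h.base, h.mulK, h.n]
  norm_num
  constructor <;> intro h₁ <;> simp [h₁]

/-- Cells of different trees have different addresses. -/
theorem tree_disjoint {k w i j i' j' v v' : ℕ} (hj : j < k) (hj' : j' < k) (hv : v < w)
    (hv' : v' < w) (h : (i * k + j) * w + v = (i' * k + j') * w + v') : i = i' ∧ j = j' := by
  have h₁ : i * k + j = i' * k + j' := by
    have h := congrArg (· / w) h
    simpa [Nat.add_div_of_dvd_right, Nat.mul_add_div, mul_comm _ w, (by omega : 0 < w),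
      Nat.div_eq_of_lt hv, Nat.div_eq_of_lt hv'] using h
  have h₂ : i = i' := by
    have h := congrArg (· / k) h₁
    simpa [Nat.mul_add_div, mul_comm _ k, (by omega : 0 < k),
      Nat.div_eq_of_lt hj, Nat.div_eq_of_lt hj'] using h
  subst h₂
  exact ⟨rfl, by omega⟩

theorem updateRow_ends {s : State} {a : ℕ → ℕ} {e v c : ℕ} (hV : 𝒟.Valid) (h : 𝒟.Holds s)
    (he : s.natVar 9 = e) (hc : s.natVar 10 = c) (he' : e < 𝒟.n) (hc' : c < 𝒟.k)
    (ha : s.natArr 1 = Function.update a e v) (hrow : 𝒟.Row a (s.natArr 5) c) :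
    Ends .updateRow s (𝒟.k * (Nat.log 2 (2 * 𝒟.n) * 74 + 52) + 6) fun s' =>
      𝒟.Row (Function.update a e v) (s'.natArr 5) c ∧
      ∀ i a', i ≠ c → 𝒟.Row a' (s.natArr 5) i → 𝒟.Row a' (s'.natArr 5) i := by
  have hloop := Ends.forLoop (x := 6) (y := 1) (p := .seq .setLeaf .climb) (s := s) (B := 𝒟.k)
    (T := 40 + (Nat.log 2 (2 * 𝒟.n) * 74 + 4))
    (fun J s' => (∀ j < J, IsTournament 𝒟.n (𝒟.key c j) (Function.update a e v) c
        (fun v => s'.natArr 5 ((c * 𝒟.k + j) * (2 * 𝒟.n) + v)) 0) ∧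
      (∀ i j w, j < 𝒟.k → w < 2 * 𝒟.n → (i ≠ c ∨ J ≤ j) →
        s'.natArr 5 ((i * 𝒟.k + j) * (2 * 𝒟.n) + w) =
          s.natArr 5 ((i * 𝒟.k + j) * (2 * 𝒟.n) + w)))
    (by decide) h.k (by decide) (fun _ _ _ h => h) ⟨by simp, fun _ _ _ _ _ _ => rfl⟩ ?_
  · refine hloop.mono (le_of_eq (by ring)) ?_
    rintro s' - ⟨h₁, h₂⟩
    refine ⟨h₁, fun i a' hi hr j hj => (hr j hj).congr (fun _ _ => Iff.rfl) fun w hw => ?_⟩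
    exact h₂ i j w hj hw (.inl hi)
  · rintro J hJ s₁ hf hx ⟨h₁, h₂⟩
    have hH := h.frame hf (by decide) (by decide) (by decide) (by decide) (by decide) (by decide)
      (by decide)
    have e9 : s₁.natVar 9 = e := (hf.natVar 9 (by decide)).trans he
    have e10 : s₁.natVar 10 = c := (hf.natVar 10 (by decide)).trans hc
    have a1 : s₁.natArr 1 = Function.update a e v := (hf.natArr 1 (by decide)).trans ha
    refine (setLeaf_ends hH).seq ?_
    rintro s₂ hf₂ ⟨h11, h12, h5⟩
    rw [e9] at h11
    rw [e10, hx, hV.base_eq hc' hJ] at h12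
    rw [h12, h11, e9, e10, a1, Function.update_self] at h5
    have hH₂ := hH.frame hf₂ (by decide) (by decide) (by decide) (by decide) (by decide)
      (by decide) (by decide)
    have f10 : s₂.natVar 10 = c := (hf₂.natVar 10 (by decide)).trans e10
    have f6 : s₂.natVar 6 = J := (hf₂.natVar 6 (by decide)).trans hx
    -- The cells of tree `J` are still untouched, so it is correct for the old allotment.
    have ht := (hrow J hJ).congr (val' := fun v => s₁.natArr 5 ((c * 𝒟.k + J) * (2 * 𝒟.n) + v))
      (fun _ _ => Iff.rfl) (fun w hw => h₂ c J w hJ hw (.inr le_rfl))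
    have ht' := ht.update_leaf e v
    refine (climb_ends (a := Function.update a e v) hH₂ (by omega) (by omega) ?_).imp ?_
    · rw [f10, f6, h11, h12]
      convert ht' using 1
      funext w
      rw [h5]
      simp only [Function.update_apply]
      by_cases hw : w = 𝒟.n + e
      · simp [hw]
      · rw [if_neg (by omega), if_neg hw]
    · rw [f10, f6, h12]
      rintro s₃ - ⟨h₃, h₄⟩
      have hother : ∀ i j w, j < 𝒟.k → w < 2 * 𝒟.n → (i ≠ c ∨ j ≠ J) →
          s₃.natArr 5 ((i * 𝒟.k + j) * (2 * 𝒟.n) + w) =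
            s₁.natArr 5 ((i * 𝒟.k + j) * (2 * 𝒟.n) + w) := by
        intro i j w hj hw hne
        have hd : ∀ w' < 2 * 𝒟.n, (i * 𝒟.k + j) * (2 * 𝒟.n) + w ≠
            (c * 𝒟.k + J) * (2 * 𝒟.n) + w' := fun w' hw' heq => by
          have := tree_disjoint hj hJ hw hw' heq
          omega
        rw [h₄ _ hd, h5, Function.update_of_ne (hd _ (by omega))]
      refine ⟨fun j hj => ?_, fun i j w hj hw hne => ?_⟩
      · rcases Nat.lt_succ_iff_lt_or_eq.mp hj with hj | rfl
        · exact (h₁ j hj).congr (fun _ _ => Iff.rfl)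
            fun w hw => hother c j w (by omega) hw (.inr (by omega))
        · exact h₃
      · rw [hother i j w hj hw (by omega), h₂ i j w hj hw (by omega)]

/-! ### Walking along an augmenting path -/

/-- The situation after the path has been followed back from its end to the center `v`: the demand
unit `m` is still to be inserted, and `v` still lacks a demand unit; `v = k` means that all is done.
The rest of the path is given by `dem`, where the numbers `rank` decrease along the path. -/
structure Augmenting (𝒟 : Data) (y : ℕ → ℝ) (m : ℕ) (rank dem occ : ℕ → ℕ) (v : ℕ) (a tr : ℕ → ℕ) :
    Prop where
  lt : ∀ d < m, a d < 𝒟.k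
  self_lt : v = 𝒟.k → a m < 𝒟.k
  self_eq : v < 𝒟.k → a m = 𝒟.k
  gt : ∀ d, m < d → d < 𝒟.n → a d = 𝒟.k
  prefers : ∀ d ≤ m, a d < 𝒟.k → Prefers 𝒟.k 𝒟.C y d (a d)
  count : ∀ i < 𝒟.k, count 𝒟.n a i + (if v = i then 1 else 0) = occ i
  path : v < 𝒟.k → ∀ u < 𝒟.k, rank u ≤ rank v → dem u ≤ m ∧ Prefers 𝒟.k 𝒟.C y (dem u) u ∧
    (a (dem u) = 𝒟.k ∨ (a (dem u) < 𝒟.k ∧ rank (a (dem u)) < rank u))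
  row : ∀ i < 𝒟.k, 𝒟.Row a tr i

/-- Filling `v` with `dem v` leaves the former center of `dem v` one unit short, unless `dem v` is
the new unit `m`, whose former center is the fictitious `k`. -/
theorem Augmenting.step {y : ℕ → ℝ} {m : ℕ} {rank dem occ : ℕ → ℕ} {v : ℕ} {a tr tr' : ℕ → ℕ}
    (hm : m < 𝒟.n) (h : Augmenting 𝒟 y m rank dem occ v a tr) (hv : v < 𝒟.k)
    (hrow : ∀ i < 𝒟.k, 𝒟.Row (Function.update a (dem v) v) tr' i) :
    Augmenting 𝒟 y m rank dem occ (a (dem v)) (Function.update a (dem v) v) tr' := by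
  obtain ⟨hdm, hpref, hnext⟩ := h.path hv v hv le_rfl
  have hself := h.self_eq hv
  have heq : a (dem v) = 𝒟.k → dem v = m := fun h0 => by
    by_contra hne
    have := h.lt _ (lt_of_le_of_ne hdm hne)
    omega
  refine ⟨fun d hd => ?_, fun h0 => ?_, fun h0 => ?_, fun d hd hd' => ?_, fun d hd hk => ?_,
    fun i hi => ?_, fun h0 u hu hur => ?_, hrow⟩
  · rw [Function.update_apply]
    split_ifs
    exacts [hv, h.lt d hd]
  · simpa [heq h0] using hv
  · rw [Function.update_of_ne, hself]
    rintro rfl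
    omega
  · rw [Function.update_of_ne (by omega), h.gt d hd hd']
  · by_cases hde : d = dem v
    · subst hde
      simpa using hpref
    · rw [Function.update_of_ne hde] at hk ⊢
      exact h.prefers d hd hk
  · rw [count_update a (lt_of_le_of_lt hdm hm), h.count i hi]
  · have hlt := (hnext.resolve_left (by omega)).2
    obtain ⟨h₁, h₂, h₃⟩ := h.path hv u hu (by omega)
    refine ⟨h₁, h₂, ?_⟩
    rwa [Function.update_of_ne]
    -- The moved unit does not occur again further back: otherwise its former center would have rank
    -- smaller than itself.
    intro hde
    rw [hde] at h₃
    omega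

theorem walkStep_ends {s : State} {y : ℕ → ℝ} {m : ℕ} {rank dem occ : ℕ → ℕ} {v : ℕ}
    (hV : 𝒟.Valid) (h : 𝒟.Holds s) (hm : m < 𝒟.n) (hdem : s.natArr 8 = dem)
    (hv : s.natVar 8 = v) (hvk : v < 𝒟.k)
    (hA : Augmenting 𝒟 y m rank dem occ v (s.natArr 1) (s.natArr 5)) :
    Ends .walkStep s (2 * (𝒟.k * (Nat.log 2 (2 * 𝒟.n) * 74 + 52)) + 50) fun s' =>
      s'.natVar 8 = s.natArr 1 (dem v) ∧
      Augmenting 𝒟 y m rank dem occ (s'.natVar 8) (s'.natArr 1) (s'.natArr 5) := by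
  obtain ⟨hdm, -, hnext⟩ := hA.path hvk v hvk le_rfl
  set a := s.natArr 1 with ha
  set e := dem v with he
  have hp : a e ≠ v := by
    rintro heq
    rw [heq] at hnext
    omega
  have first : Ends (.seq (.setNat 9 (.arr 8 (.var 8)))
      (.seq (.setNat 15 (.arr 1 (.var 9))) (.storeNat 1 (.var 9) (.var 8)))) s 20 fun s' =>
      s'.natVar 9 = e ∧ s'.natVar 15 = a e ∧ s'.natArr 1 = Function.update a e v := by
    refine Ends.of_wp (by decide) ?_
    simp [Prog.wp, NatExpr.eval, natVar_setNat, natArr_setNat, natArr_storeNat, natVar_storeNat,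
      hdem, hv, ← ha, ← he]
  refine (first.seq (T' := (7 + (𝒟.k * (Nat.log 2 (2 * 𝒟.n) * 74 + 52) + 6)) + 1 + 3 +
    (2 + (𝒟.k * (Nat.log 2 (2 * 𝒟.n) * 74 + 52) + 6) + 2)) ?_).mono (by omega) fun _ _ h => h
  rintro s₁ hf₁ ⟨h9, h15, h1⟩
  have hH₁ := h.frame hf₁ (by decide) (by decide) (by decide) (by decide) (by decide) (by decide)
    (by decide)
  have h5 : s₁.natArr 5 = s.natArr 5 := hf₁.natArr 5 (by decide)
  have h8 : s₁.natVar 8 = v := (hf₁.natVar 8 (by decide)).trans hv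
  have second : Ends (.cond (.natLt (.var 15) (.var 1)) (.seq (.setNat 10 (.var 15)) .updateRow)
      .skip) s₁ ((7 + (𝒟.k * (Nat.log 2 (2 * 𝒟.n) * 74 + 52) + 6)) + 3 + 1) fun s' =>
      (a e < 𝒟.k → 𝒟.Row (Function.update a e v) (s'.natArr 5) (a e)) ∧
      ∀ i a', i ≠ a e → 𝒟.Row a' (s.natArr 5) i → 𝒟.Row a' (s'.natArr 5) i := by
    refine (Ends.cond (T := 7 + (𝒟.k * (Nat.log 2 (2 * 𝒟.n) * 74 + 52) + 6)) ?_ ?_).mono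
      (by simp only [Test.steps, NatExpr.steps]; omega) fun _ _ h => h
    · intro hb
      simp only [Test.Holds, NatExpr.eval, h15, hH₁.k] at hb
      refine ((Ends.of_wp (T := 7) (Q := fun s' => s'.natVar 10 = a e) (by decide) ?_).seq ?_)
      · simp [Prog.wp, NatExpr.eval, natVar_setNat, h15]
      · intro s₂ hf₂ h10
        have hH₂ := hH₁.frame hf₂ (by decide) (by decide) (by decide) (by decide) (by decide)
          (by decide) (by decide)
        have h5' : s₂.natArr 5 = s.natArr 5 := (hf₂.natArr 5 (by decide)).trans h5
        refine (updateRow_ends (a := a) (v := v) hV hH₂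
          ((hf₂.natVar 9 (by decide)).trans h9) h10 (by omega) hb
          ((hf₂.natArr 1 (by decide)).trans h1) (h5' ▸ hA.row _ hb)).imp ?_
        rintro s₃ - ⟨h₁, h₂⟩
        exact ⟨fun _ => h₁, h5' ▸ h₂⟩
    · intro hb
      simp only [Test.Holds, NatExpr.eval, h15, hH₁.k] at hb
      exact Ends.of_wp (by simp only [Prog.steps]; omega)
        ⟨fun h => absurd h hb, fun i a' _ hr => h5 ▸ hr⟩
  refine (second.seq (T' := (2 + (𝒟.k * (Nat.log 2 (2 * 𝒟.n) * 74 + 52) + 6) + 2)) ?_).mono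
    (by omega) fun _ _ h => h
  rintro s₂ hf₂ ⟨hpRow, hRow⟩
  have hH₂ := hH₁.frame hf₂ (by decide) (by decide) (by decide) (by decide) (by decide)
    (by decide) (by decide)
  have third : Ends (.seq (.setNat 10 (.var 8)) .updateRow) s₂
      (2 + (𝒟.k * (Nat.log 2 (2 * 𝒟.n) * 74 + 52) + 6)) fun s' =>
      ∀ i < 𝒟.k, 𝒟.Row (Function.update a e v) (s'.natArr 5) i := by
    refine ((Ends.of_wp (T := 2) (Q := fun s' => s'.natVar 10 = v) (by decide) ?_).seq ?_)
    · simp [Prog.wp, NatExpr.eval, natVar_setNat, hf₂.natVar 8 (by decide), h8]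
    · intro s₃ hf₃ h10
      have hH₃ := hH₂.frame hf₃ (by decide) (by decide) (by decide) (by decide) (by decide)
        (by decide) (by decide)
      have h5' : s₃.natArr 5 = s₂.natArr 5 := hf₃.natArr 5 (by decide)
      refine (updateRow_ends (a := a) (v := v) hV hH₃
        (((hf₃.natVar 9 (by decide)).trans (hf₂.natVar 9 (by decide))).trans h9) h10 (by omega)
        hvk (((hf₃.natArr 1 (by decide)).trans (hf₂.natArr 1 (by decide))).trans h1)
        (h5' ▸ hRow v a (Ne.symm hp) (hA.row v hvk))).imp ?_
      rintro s₄ - ⟨h₁, h₂⟩ i hi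
      by_cases hiv : i = v
      · exact hiv ▸ h₁
      · refine h₂ i _ hiv (h5' ▸ ?_)
        by_cases hip : i = a e
        · subst hip
          exact hpRow hi
        -- The moved unit is at center `i` neither before nor after, so the trees of `i` serve both
        -- allotments.
        · refine hRow i _ hip fun j hj => (hA.row i hi j hj).congr (fun d _ => ?_) fun _ _ => rfl
          rw [Function.update_apply]
          split_ifs with hd
          · subst hd
            exact ⟨fun h => absurd h.symm hip, fun h => absurd h.symm hiv⟩
          · exact Iff.rfl
  refine third.seq ?_
  intro s₃ hf₃ hrow
  refine Ends.of_wp (by decide) ?_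
  have e15 : s₃.natVar 15 = a e :=
    ((hf₃.natVar 15 (by decide)).trans (hf₂.natVar 15 (by decide))).trans h15
  have e1 : s₃.natArr 1 = Function.update a e v :=
    ((hf₃.natArr 1 (by decide)).trans (hf₂.natArr 1 (by decide))).trans h1
  simp only [Prog.wp, NatExpr.eval, natVar_setNat, natArr_setNat, e15, e1, if_true, true_and]
  exact hA.step hm hvk hrow

theorem walk_ends {s : State} {y : ℕ → ℝ} {m : ℕ} {rank dem occ : ℕ → ℕ} {v : ℕ}
    (hV : 𝒟.Valid) (h : 𝒟.Holds s) (hm : m < 𝒟.n) (hdem : s.natArr 8 = dem)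
    (hv : s.natVar 8 = v) (hrank : ∀ i < 𝒟.k, rank i ≠ 0 ∧ rank i ≤ 𝒟.k) (hvk : v < 𝒟.k)
    (hA : Augmenting 𝒟 y m rank dem occ v (s.natArr 1) (s.natArr 5)) :
    Ends .walk s (𝒟.k * (2 * (𝒟.k * (Nat.log 2 (2 * 𝒟.n) * 74 + 52)) + 54) + 4) fun s' =>
      Augmenting 𝒟 y m rank dem occ 𝒟.k (s'.natArr 1) (s'.natArr 5) := by
  refine (Ends.loop (T := 2 * (𝒟.k * (Nat.log 2 (2 * 𝒟.n) * 74 + 52)) + 50)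
    (fun s' => Prog.walk.Frame s s' ∧ s'.natVar 8 ≤ 𝒟.k ∧
      Augmenting 𝒟 y m rank dem occ (s'.natVar 8) (s'.natArr 1) (s'.natArr 5))
    -- Ranks lie between 1 and `k` and decrease along the path; the value 0 is reserved for the end,
    -- so there are at most `k` moves.
    (fun s' => if s'.natVar 8 < 𝒟.k then rank (s'.natVar 8) else 0) ?_
    ⟨.refl _ _, by omega, hv ▸ hA⟩).mono ?_ ?_
  · rintro s' ⟨hf, -, hA'⟩ hb
    have hH := h.frame hf (by decide) (by decide) (by decide) (by decide) (by decide) (by decide)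
      (by decide)
    simp only [Test.Holds, NatExpr.eval, hH.k] at hb
    refine (walkStep_ends hV hH hm ((hf.natArr 8 (by decide)).trans hdem) rfl hb hA').imp ?_
    rintro s'' hf' ⟨h8, hA''⟩
    have hpath := (hA'.path hb _ hb le_rfl).2.2
    rw [← h8] at hpath
    refine ⟨⟨hf.trans hf'.loop, by omega, hA''⟩, ?_⟩
    have := (hrank _ hb).1
    rw [if_pos hb]
    split_ifs <;> omega
  · have := (hrank v hvk).2
    rw [hv, if_pos hvk]
    exact Nat.add_le_add_right (Nat.mul_le_mul_right _ this) 4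
  · rintro s' - ⟨⟨hf, hle, hA'⟩, hb⟩
    have hH := h.frame hf (by decide) (by decide) (by decide) (by decide) (by decide) (by decide)
      (by decide)
    simp only [Test.Holds, NatExpr.eval, hH.k] at hb
    rwa [show s'.natVar 8 = 𝒟.k by omega] at hA'

/-! ### The search for a shortest augmenting path -/

theorem startSearch_ends {s : State} {m : ℕ} (hV : 𝒟.Valid) (h : 𝒟.Holds s)
    (hm : s.natVar 4 = m) (hmn : m < 𝒟.n) :
    Ends .startSearch s (𝒟.k * 28 + 6) fun s' => ∀ j < 𝒟.k,
      s'.realArr 3 j = 𝒟.C m j ∧ s'.natArr 7 j = 0 ∧ s'.natArr 8 j = m := by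
  refine Ends.forLoop (T := 20) (fun J s' => ∀ j < J,
    s'.realArr 3 j = 𝒟.C m j ∧ s'.natArr 7 j = 0 ∧ s'.natArr 8 j = m) (by decide) h.k (by decide)
    (fun _ _ _ h => h) (by simp) ?_
  intro J hJ s' hf hx hI
  have hH := h.frame hf (by decide) (by decide) (by decide) (by decide) (by decide) (by decide)
    (by decide)
  have h4 : s'.natVar 4 = m := (hf.natVar 4 (by decide)).trans hm
  refine Ends.of_wp (by decide) fun j hj => ?_
  simp only [NatExpr.eval, RealExpr.eval, natVar_storeNat, natVar_storeReal, natArr_storeNat,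
    natArr_storeReal, realArr_storeNat, realArr_storeReal, hx, h4, hH.cost, hH.mulK,
    hV.mulK m (by omega)]
  rcases Nat.lt_succ_iff_lt_or_eq.mp hj with hj | rfl
  · simpa [Function.update_of_ne hj.ne] using hI j hj
  · simp [Data.C]

/-- The value `k` in variable 7 means that nothing is selected yet. The second conjunct of the
program's test is "nothing selected, or strictly better", written without disjunction. -/
theorem select_ends {s : State} (h : 𝒟.Holds s) (hex : ∃ j < 𝒟.k, s.natArr 7 j = 0) :
    Ends .select s (𝒟.k * 38 + 8) fun s' => s'.natVar 7 < 𝒟.k ∧ s.natArr 7 (s'.natVar 7) = 0 ∧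
      ∀ j < 𝒟.k, s.natArr 7 j = 0 →
        s.realArr 3 (s'.natVar 7) + s.realArr 2 (s'.natVar 7) ≤ s.realArr 3 j + s.realArr 2 j := by
  have first : Ends (.setNat 7 (.var 1)) s 2 fun s' => s'.natVar 7 = 𝒟.k :=
    Ends.of_wp (by decide) (by simp [Prog.wp, NatExpr.eval, natVar_setNat, h.k])
  refine (first.seq (T' := 𝒟.k * (30 + 8) + 6) ?_).mono (by omega) fun _ _ h => h
  intro s₁ hf₁ h7
  have hH₁ := h.frame hf₁ (by decide) (by decide) (by decide) (by decide) (by decide) (by decide)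
    (by decide)
  refine (Ends.forLoop (x := 6) (y := 1) (fun J s' => (s'.natVar 7 = 𝒟.k ∧ ∀ j < J, s.natArr 7 j ≠ 0) ∨
    (s'.natVar 7 < 𝒟.k ∧ s.natArr 7 (s'.natVar 7) = 0 ∧ ∀ j < J, s.natArr 7 j = 0 →
      s.realArr 3 (s'.natVar 7) + s.realArr 2 (s'.natVar 7) ≤ s.realArr 3 j + s.realArr 2 j))
    (by decide) hH₁.k (by decide) (fun _ _ _ h => h) (.inl ⟨h7, by simp⟩) ?_).imp ?_
  · intro J hJ s' hf hx hI
    have hH := hH₁.frame hf (by decide) (by decide) (by decide) (by decide) (by decide) (by decide)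
      (by decide)
    have e7 : s'.natArr 7 = s.natArr 7 :=
      (hf.natArr 7 (by decide)).trans (hf₁.natArr 7 (by decide))
    have e3 : s'.realArr 3 = s.realArr 3 :=
      (hf.realArr 3 (by decide)).trans (hf₁.realArr 3 (by decide))
    have e2 : s'.realArr 2 = s.realArr 2 :=
      (hf.realArr 2 (by decide)).trans (hf₁.realArr 2 (by decide))
    refine Ends.of_wp (by decide) ?_
    simp only [Prog.wp, Test.Holds, NatExpr.eval, RealExpr.eval, natVar_setNat, hx, e7, e3, e2,
      hH.k, if_true]
    refine ⟨fun ⟨h0, hlt⟩ => .inr ⟨hJ, h0, fun j hj hj0 => ?_⟩, fun hn => ?_⟩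
    · rcases Nat.lt_succ_iff_lt_or_eq.mp hj with hj | rfl
      · rcases hI with ⟨-, hI⟩ | ⟨h₁, -, h₂⟩
        · exact (hI j hj hj0).elim
        · have := h₂ j hj hj0
          by_contra hc
          exact hlt ⟨h₁.ne, fun h => by linarith⟩
      · exact le_rfl
    · rcases hI with ⟨h₁, h₂⟩ | ⟨h₁, h₂, h₃⟩
      · refine .inl ⟨h₁, fun j hj hj0 => ?_⟩
        rcases Nat.lt_succ_iff_lt_or_eq.mp hj with hj | rfl
        · exact h₂ j hj hj0
        · exact hn ⟨hj0, fun h => h.1 h₁⟩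
      · refine .inr ⟨h₁, h₂, fun j hj hj0 => ?_⟩
        rcases Nat.lt_succ_iff_lt_or_eq.mp hj with hj | rfl
        · exact h₃ j hj hj0
        · by_contra hc
          exact hn ⟨hj0, fun h => h.2 (by linarith)⟩
  · rintro s' - (⟨-, h₁⟩ | h₁)
    · obtain ⟨j, hj, hj0⟩ := hex
      exact (h₁ j hj hj0).elim
    · exact h₁

theorem relax_ends {s : State} {a : ℕ → ℕ} {m b : ℕ} (hV : 𝒟.Valid) (h : 𝒟.Holds s)
    (hb : s.natVar 7 = b) (hbk : b < 𝒟.k) (hb0 : s.natArr 7 b ≠ 0) (hm : m ≤ 𝒟.n)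
    (ha : ∀ d, m ≤ d → d < 𝒟.n → a d = 𝒟.k) (hrow : 𝒟.Row a (s.natArr 5) b) :
    Ends .relax s (𝒟.k * 68 + 6) fun s' => ∀ j < 𝒟.k, Relaxed 𝒟.C a m b (s.realArr 3)
      (s'.realArr 3) (s.natArr 7) (s.natArr 8) (s'.natArr 8) j := by
  refine (Ends.forLoop (T := 60) (fun J s' => (∀ j < J, Relaxed 𝒟.C a m b (s.realArr 3)
      (s'.realArr 3) (s.natArr 7) (s.natArr 8) (s'.natArr 8) j) ∧
      (∀ j, J ≤ j → s'.realArr 3 j = s.realArr 3 j ∧ s'.natArr 8 j = s.natArr 8 j) ∧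
      -- The loop rereads the distance of `b` while overwriting distances; `b` is already final, so
      -- its entry stays fixed.
      s'.realArr 3 b = s.realArr 3 b)
    (by decide) h.k (by decide) (fun _ _ _ h => h) ⟨by simp, by simp, rfl⟩ ?_).imp
    fun _ _ h => h.1
  rintro J hJ s' hf hx ⟨h₁, h₂, h₃⟩
  have hH := h.frame hf (by decide) (by decide) (by decide) (by decide) (by decide) (by decide)
    (by decide)
  have e7 : s'.natArr 7 = s.natArr 7 := hf.natArr 7 (by decide)
  have e5 : s'.natArr 5 = s.natArr 5 := hf.natArr 5 (by decide)
  have e7' : s'.natVar 7 = b := (hf.natVar 7 (by decide)).trans hb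
  obtain ⟨h₂D, h₂dem⟩ := h₂ J le_rfl
  refine Ends.of_wp (by decide) ?_
  simp only [Prog.wp, Test.Holds, NatExpr.eval, RealExpr.eval, natVar_setNat, natArr_setNat,
    realArr_setNat, natVar_setReal, natArr_setReal, realArr_setReal, realVar_setReal,
    natVar_storeReal, natArr_storeReal, natArr_storeNat, realArr_storeNat, realArr_storeReal,
    hx, e7, e5, e7', hH.base, hH.mulK, hH.cost]
  norm_num only [if_true, if_false]
  rw [hV.base_eq hbk hJ]
  rcases (hrow J hJ).root hV.n_pos with ⟨h0, hnone⟩ | ⟨d, hd, h1, had, hmin⟩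
  · refine ⟨fun hc => absurd h0 hc.2.1, fun _ => ⟨fun j hj => ?_, fun j hj => h₂ j (by omega), h₃⟩⟩
    rcases Nat.lt_succ_iff_lt_or_eq.mp hj with hj | rfl
    · exact h₁ j hj
    · exact .inl ⟨h₂D, h₂dem, fun _ d hd had => absurd had (hnone d (by omega))⟩
  -- Units not yet inserted carry the value `k` and cannot win a tree of a real center.
  · have hdm : d < m := by
      by_contra hc
      have := ha d (by omega) hd
      omega
    have hmin' : ∀ d' < m, a d' = b → 𝒟.C d J - 𝒟.C d b ≤ 𝒟.C d' J - 𝒟.C d' b :=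
      fun d' hd' had' => by
        have := hmin d' (by omega) had'
        rwa [hV.key_eq hd, hV.key_eq (by omega)] at this
    simp only [h1, Nat.add_sub_cancel, hV.mulK d (by omega)]
    refine ⟨fun ⟨hJ0, _, hlt⟩ => ?_, fun hn => ⟨fun j hj => ?_, fun j hj => h₂ j (by omega), h₃⟩⟩
    · have hJb : b ≠ J := by
        rintro rfl
        exact hb0 hJ0
      refine ⟨fun j hj => ?_, fun j hj => ?_, ?_⟩
      · rcases Nat.lt_succ_iff_lt_or_eq.mp hj with hj | rfl
        · have := h₁ j hj
          unfold Relaxed at this ⊢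
          rwa [Function.update_of_ne hj.ne, Function.update_of_ne hj.ne]
        · refine .inr ⟨hJ0, by simpa using hdm, by simpa using had, by simp [Data.C, h₃], ?_, ?_⟩
          · rw [Function.update_self, ← h₂D]
            exact hlt.le
          · intro d' hd' had'
            have := hmin' d' hd' had'
            simp only [Function.update_self]
            unfold Data.C at this ⊢
            linarith
      · rw [Function.update_of_ne (by omega), Function.update_of_ne (by omega)]
        exact h₂ j (by omega)
      · rw [Function.update_of_ne hJb, h₃]
    · rcases Nat.lt_succ_iff_lt_or_eq.mp hj with hj | rfl
      · exact h₁ j hj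
      · refine .inl ⟨h₂D, h₂dem, fun hJ0 d' hd' had' => ?_⟩
        have := hmin' d' hd' had'
        have hle := not_lt.mp fun hlt => hn ⟨hJ0, by simp, hlt⟩
        unfold Data.C at this ⊢
        linarith

theorem count_le (n : ℕ) (a : ℕ → ℕ) (i : ℕ) : count n a i ≤ n := by
  simpa [count] using Finset.card_filter_le (Finset.range n) fun d => a d = i

theorem count_eq_self {n : ℕ} {a : ℕ → ℕ} {i : ℕ} (h : ∀ d < n, a d = i) : count n a i = n := by
  simp [count, Finset.filter_true_of_mem fun d hd => h d (Finset.mem_range.mp hd)]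

theorem count_eq_zero {n : ℕ} {a : ℕ → ℕ} {i : ℕ} : count n a i = 0 ↔ ∀ d < n, a d ≠ i := by
  simp [count, Finset.filter_eq_empty_iff]

/-- The allotment `a` of the demand units `0, …, m - 1`, its occupancies, prices that certify its
optimality, and its tournament trees. -/
structure Allotment (𝒟 : Data) (δ : ℕ → ℕ → ℝ) (m : ℕ) (a occ : ℕ → ℕ) (y : ℕ → ℝ)
    (tr : ℕ → ℕ) : Prop where
  lt : ∀ d < m, a d < 𝒟.k
  ge : ∀ d, m ≤ d → d < 𝒟.n → a d = 𝒟.k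
  prefers : ∀ d < m, Prefers 𝒟.k 𝒟.C y d (a d)
  count : ∀ i < 𝒟.k, LBDD.count 𝒟.n a i = occ i
  lower : ∀ i < 𝒟.k, δ i (occ i) ≤ y i
  upper : ∀ i < 𝒟.k, y i ≤ δ i (occ i + 1)
  row : ∀ i < 𝒟.k, 𝒟.Row a tr i

theorem search_ends {s : State} {δ : ℕ → ℕ → ℝ} {m : ℕ} (hV : 𝒟.Valid) (h : 𝒟.Holds s)
    (hm : s.natVar 4 = m) (hmn : m < 𝒟.n)
    (hA : Allotment 𝒟 δ m (s.natArr 1) (s.natArr 6) (s.realArr 2) (s.natArr 5)) :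
    Ends .search s (𝒟.k * (𝒟.k * 106 + 58) + 12) fun s' =>
      Searching 𝒟.k 𝒟.C (s.natArr 1) (s.realArr 2) m (s'.realArr 3) (s'.natArr 7) (s'.natArr 8) ∧
        ∀ i < 𝒟.k, s'.natArr 7 i ≠ 0 ∧ s'.natArr 7 i ≤ 𝒟.k := by
  refine ((startSearch_ends hV h hm hmn).seq
    (T' := 𝒟.k * ((𝒟.k * 38 + 8 + (8 + (𝒟.k * 68 + 6))) + 8) + 6) ?_).mono
    (le_of_eq (by ring)) fun _ _ h => h
  intro s₁ hf₁ hs₁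
  have hH₁ := h.frame hf₁ (by decide) (by decide) (by decide) (by decide) (by decide) (by decide)
    (by decide)
  refine (Ends.forLoop (fun r s' =>
    Searching 𝒟.k 𝒟.C (s.natArr 1) (s.realArr 2) m (s'.realArr 3) (s'.natArr 7) (s'.natArr 8) ∧
      -- Each round makes one center final; the count guarantees a candidate in every round and none
      -- after the last.
      (∀ i < 𝒟.k, s'.natArr 7 i ≤ r) ∧ count 𝒟.k (s'.natArr 7) 0 + r = 𝒟.k)
    (by decide) hH₁.k (by decide) (fun _ _ _ h => h) ⟨.init _ _ _ _ _ (fun j hj => (hs₁ j hj).1)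
      (fun j hj => (hs₁ j hj).2.1) (fun j hj => (hs₁ j hj).2.2), fun i hi => (hs₁ i hi).2.1.le,
      count_eq_self fun j hj => (hs₁ j hj).2.1⟩ ?_).imp ?_
  · rintro r hr s₂ hf₂ hx ⟨hS, hle, hcount⟩
    have hH₂ := hH₁.frame hf₂ (by decide) (by decide) (by decide) (by decide) (by decide)
      (by decide) (by decide)
    have hex : ∃ j < 𝒟.k, s₂.natArr 7 j = 0 := by
      by_contra hc
      push Not at hc
      rw [count_eq_zero.mpr hc] at hcount
      omega
    refine (select_ends hH₂ hex).seq ?_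
    rintro s₃ hf₃ ⟨hb, hb0, hmin⟩
    have hH₃ := hH₂.frame hf₃ (by decide) (by decide) (by decide) (by decide) (by decide)
      (by decide) (by decide)
    have second : Ends (.storeNat 7 (.var 7) (.add (.var 5) (.const 1))) s₃ 8 fun s' =>
        s'.natArr 7 = Function.update (s₂.natArr 7) (s₃.natVar 7) (r + 1) := by
      refine Ends.of_wp (by decide) ?_
      simp [Prog.wp, NatExpr.eval, natArr_storeNat, hf₃.natArr 7 (by decide),
        hf₃.natVar 5 (by decide), hx]
    refine second.seq ?_
    intro s₄ hf₄ h7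
    have hH₄ := hH₃.frame hf₄ (by decide) (by decide) (by decide) (by decide) (by decide)
      (by decide) (by decide)
    have e5 : s₄.natArr 5 = s.natArr 5 := by
      rw [hf₄.natArr 5 (by decide), hf₃.natArr 5 (by decide), hf₂.natArr 5 (by decide),
        hf₁.natArr 5 (by decide)]
    have e2 : s₂.realArr 2 = s.realArr 2 := by
      rw [hf₂.realArr 2 (by decide), hf₁.realArr 2 (by decide)]
    rw [e2] at hmin
    refine (relax_ends (a := s.natArr 1) (m := m) hV hH₄ (hf₄.natVar 7 (by decide)) hb
      (by simp [h7]) hmn.le hA.ge (e5 ▸ hA.row _ hb)).imp ?_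
    intro s₅ hf₅ hrel
    rw [h7, hf₄.realArr 3 (by decide), hf₃.realArr 3 (by decide), hf₄.natArr 8 (by decide),
      hf₃.natArr 8 (by decide)] at hrel
    rw [hf₅.natArr 7 (by decide), h7]
    refine ⟨hS.step hA.prefers hle hb hb0 hmin hrel, fun i hi => ?_, ?_⟩
    · rw [Function.update_apply]
      split_ifs
      · exact le_rfl
      · exact (hle i hi).trans (Nat.le_succ r)
    · have := count_update (s₂.natArr 7) hb (r + 1) 0
      rw [if_pos hb0, if_neg (Nat.succ_ne_zero r)] at this
      omega
  · rintro s' - ⟨hS, hle, hcount⟩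
    exact ⟨hS, fun i hi => ⟨count_eq_zero.mp (by omega) i hi, hle i hi⟩⟩

/-! ### The end of the path and the new prices. -/

theorem chooseTarget_ends {s : State} {δ : ℕ → ℕ → ℝ} (hV : 𝒟.Valid) (h : 𝒟.Holds s)
    (hδ : ∀ i < 𝒟.k, ∀ o < 𝒟.n, δ i (o + 1) =
      if o < 𝒟.cap i then 0 else 𝒟.pen (i * 𝒟.n + (o - 𝒟.cap i)))
    (hocc : ∀ i < 𝒟.k, s.natArr 6 i < 𝒟.n) :
    Ends .chooseTarget s (𝒟.k * 58 + 8) fun s' => s'.natVar 7 < 𝒟.k ∧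
      s'.realVar 0 = s.realArr 3 (s'.natVar 7) + δ (s'.natVar 7) (s.natArr 6 (s'.natVar 7) + 1) ∧
      ∀ j < 𝒟.k, s'.realVar 0 ≤ s.realArr 3 j + δ j (s.natArr 6 j + 1) := by
  have first : Ends (.setNat 7 (.var 1)) s 2 fun s' => s'.natVar 7 = 𝒟.k :=
    Ends.of_wp (by decide) (by simp [Prog.wp, NatExpr.eval, natVar_setNat, h.k])
  refine (first.seq (T' := 𝒟.k * (50 + 8) + 6) ?_).mono (by omega) fun _ _ h => h
  intro s₁ hf₁ h7
  have hH₁ := h.frame hf₁ (by decide) (by decide) (by decide) (by decide) (by decide) (by decide)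
    (by decide)
  refine (Ends.forLoop (x := 6) (y := 1) (fun J s' => (s'.natVar 7 = 𝒟.k ∧ J = 0) ∨ (s'.natVar 7 < 𝒟.k ∧
      s'.realVar 0 = s.realArr 3 (s'.natVar 7) + δ (s'.natVar 7) (s.natArr 6 (s'.natVar 7) + 1) ∧
      ∀ j < J, s'.realVar 0 ≤ s.realArr 3 j + δ j (s.natArr 6 j + 1)))
    (by decide) hH₁.k (by decide) (fun _ _ _ h => h) (.inl ⟨h7, rfl⟩) ?_).imp ?_
  · intro J hJ s' hf hx hI
    have hH := hH₁.frame hf (by decide) (by decide) (by decide) (by decide) (by decide) (by decide)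
      (by decide)
    have e6 : s'.natArr 6 = s.natArr 6 :=
      (hf.natArr 6 (by decide)).trans (hf₁.natArr 6 (by decide))
    have e3 : s'.realArr 3 = s.realArr 3 :=
      (hf.realArr 3 (by decide)).trans (hf₁.realArr 3 (by decide))
    -- Halving a tabulated multiple of `2 * n` gives the row offset in the penalty table.
    have hbase : 𝒟.base J / 2 = J * 𝒟.n := by
      rw [hV.base J (hJ.le.trans (Nat.le_mul_self _)), Nat.mul_left_comm]
      exact Nat.mul_div_cancel_left _ (by norm_num)
    refine Ends.seq (T := 20) (T' := 30)
      (R := fun t => t.realVar 1 = s.realArr 3 J + δ J (s.natArr 6 J + 1) ∧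
        t.realVar 0 = s'.realVar 0) (Ends.of_wp (by decide) ?_) ?_
    · rw [hδ J hJ _ (hocc J hJ)]
      simp only [Prog.wp, Test.Holds, NatExpr.eval, RealExpr.eval, realVar_setReal, hx, e6, e3,
        hH.cap, hH.base, hH.pen, hbase]
      norm_num only [if_true, if_false]
      refine ⟨fun hc => by rw [if_pos hc, add_zero]; simp, fun hc => by rw [if_neg hc]; simp⟩
    · rintro t hft ⟨ht1, ht0⟩
      have t7 : t.natVar 7 = s'.natVar 7 := hft.natVar 7 (by decide)
      have t6 : t.natVar 6 = J := (hft.natVar 6 (by decide)).trans hx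
      have t1 : t.natVar 1 = 𝒟.k := (hft.natVar 1 (by decide)).trans hH.k
      refine Ends.of_wp (by decide) ?_
      simp only [Prog.wp, Test.Holds, NatExpr.eval, RealExpr.eval, realVar_setReal, natVar_setReal,
        realVar_setNat, natVar_setNat, ht1, ht0, t7, t6, t1]
      norm_num only [if_true, if_false]
      refine ⟨fun hc => .inr ⟨hJ, trivial, fun j hj => ?_⟩, fun hc => ?_⟩
      · rcases Nat.lt_succ_iff_lt_or_eq.mp hj with hj | rfl
        · rcases hI with ⟨-, rfl⟩ | ⟨h₁, -, h₂⟩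
          · exact absurd hj (Nat.not_lt_zero j)
          · by_contra hlt
            exact hc ⟨h₁.ne, fun h => by linarith [h₂ j hj]⟩
        · exact le_rfl
      · rw [not_not] at hc
        rcases hI with ⟨h₁, -⟩ | ⟨h₁, h₂, h₃⟩
        · exact absurd h₁ hc.1
        · refine .inr ⟨h₁, h₂, fun j hj => ?_⟩
          rcases Nat.lt_succ_iff_lt_or_eq.mp hj with hj | rfl
          · exact h₃ j hj
          · exact not_lt.mp hc.2
  · rintro s' - (⟨-, h₁⟩ | h₁)
    · exact absurd h₁ hV.k_pos.ne'
    · exact h₁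

theorem updatePrices_ends {s : State} (h : 𝒟.Holds s) :
    Ends .updatePrices s (𝒟.k * 28 + 6) fun s' => ∀ j < 𝒟.k,
      s'.realArr 2 j = max (s.realArr 2 j) (s.realVar 0 - s.realArr 3 j) := by
  refine (Ends.forLoop (T := 20) (fun J s' => (∀ j < J,
      s'.realArr 2 j = max (s.realArr 2 j) (s.realVar 0 - s.realArr 3 j)) ∧
      ∀ j, J ≤ j → s'.realArr 2 j = s.realArr 2 j)
    (by decide) h.k (by decide) (fun _ _ _ h => h) ⟨by simp, by simp⟩ ?_).imp fun _ _ h => h.1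
  rintro J hJ s' hf hx ⟨h₁, h₂⟩
  have e0 : s'.realVar 0 = s.realVar 0 := hf.realVar 0 (by decide)
  have e3 : s'.realArr 3 = s.realArr 3 := hf.realArr 3 (by decide)
  refine Ends.of_wp (by decide) ?_
  simp only [Prog.wp, Test.Holds, NatExpr.eval, RealExpr.eval, realArr_storeReal, hx, e0, e3,
    if_true, h₂ J le_rfl]
  refine ⟨fun hc => ⟨fun j hj => ?_, fun j hj => ?_⟩,
    fun hc => ⟨fun j hj => ?_, fun j hj => h₂ j (by omega)⟩⟩
  · rcases Nat.lt_succ_iff_lt_or_eq.mp hj with hj | rfl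
    · rw [Function.update_of_ne hj.ne, h₁ j hj]
    · rw [Function.update_self, max_eq_right hc.le]
  · rw [Function.update_of_ne (by omega), h₂ j (by omega)]
  · rcases Nat.lt_succ_iff_lt_or_eq.mp hj with hj | rfl
    · exact h₁ j hj
    · rw [h₂ j le_rfl, max_eq_left (not_lt.mp hc)]

/-! ### Insertion of one demand unit. -/

/-- An upper bound on the number of steps of an insertion in terms of the height `l` of the
tournament trees. -/
def insertBound (k l : ℕ) : ℕ :=
  k * (k * 106 + 58) + 12 + ((k * 58 + 8) + ((k * 28 + 6) + (10 +
    (k * (2 * (k * (l * 74 + 52)) + 54) + 4))))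

theorem insert_ends {s : State} {δ : ℕ → ℕ → ℝ} {m : ℕ} (hV : 𝒟.Valid) (h : 𝒟.Holds s)
    (hδ : ∀ i < 𝒟.k, ∀ o < 𝒟.n, δ i (o + 1) =
      if o < 𝒟.cap i then 0 else 𝒟.pen (i * 𝒟.n + (o - 𝒟.cap i)))
    (hmono : ∀ i < 𝒟.k, Monotone (δ i)) (hm : s.natVar 4 = m) (hmn : m < 𝒟.n)
    (hA : Allotment 𝒟 δ m (s.natArr 1) (s.natArr 6) (s.realArr 2) (s.natArr 5)) :
    Ends .insert s (insertBound 𝒟.k (Nat.log 2 (2 * 𝒟.n))) fun s' =>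
      Allotment 𝒟 δ (m + 1) (s'.natArr 1) (s'.natArr 6) (s'.realArr 2) (s'.natArr 5) := by
  unfold insertBound
  refine (search_ends hV h hm hmn hA).seq ?_
  rintro s₁ hf₁ ⟨hS, hdone⟩
  have hH₁ := h.frame hf₁ (by decide) (by decide) (by decide) (by decide) (by decide) (by decide)
    (by decide)
  have e6 : s₁.natArr 6 = s.natArr 6 := hf₁.natArr 6 (by decide)
  have hocc : ∀ i < 𝒟.k, s.natArr 6 i < 𝒟.n := by
    intro i hi
    -- Placing the unassigned unit `m` at `i` hypothetically shows that `i` holds fewer than `n`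
    -- units, so the next marginal penalty can be read from the table.
    have h₁ := count_update (s.natArr 1) hmn i i
    rw [hA.ge m le_rfl hmn, if_neg (by omega), if_pos rfl, hA.count i hi] at h₁
    have := count_le 𝒟.n (Function.update (s.natArr 1) m i) i
    omega
  refine (chooseTarget_ends hV hH₁ hδ (e6 ▸ hocc)).seq ?_
  rw [e6]
  rintro s₂ hf₂ ⟨ht, hL, hmin⟩
  have hH₂ := hH₁.frame hf₂ (by decide) (by decide) (by decide) (by decide) (by decide) (by decide)
    (by decide)
  refine (updatePrices_ends hH₂).seq ?_
  rw [hf₂.realArr 3 (by decide), hf₂.realArr 2 (by decide), hf₁.realArr 2 (by decide)]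
  intro s₃ hf₃ hy
  have hH₃ := hH₂.frame hf₃ (by decide) (by decide) (by decide) (by decide) (by decide) (by decide)
    (by decide)
  obtain ⟨g₁, g₂, g₃, g₄, g₅⟩ := hS.finish hA.lt hA.prefers (fun i hi => (hdone i hi).1) hA.lower
    hA.upper ht hL hmin hy
  have e6' : s₃.natArr 6 = s.natArr 6 := by
    rw [hf₃.natArr 6 (by decide), hf₂.natArr 6 (by decide), e6]
  have e7 : s₃.natVar 7 = s₂.natVar 7 := hf₃.natVar 7 (by decide)
  set t := s₂.natVar 7 with ht'
  have third : Ends (.seq (.storeNat 6 (.var 7) (.add (.arr 6 (.var 7)) (.const 1)))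
      (.setNat 8 (.var 7))) s₃ 10 fun s' => s'.natVar 8 = t ∧
        s'.natArr 6 = Function.update (s.natArr 6) t (s.natArr 6 t + 1) := by
    refine Ends.of_wp (by decide) ?_
    simp [Prog.wp, NatExpr.eval, natArr_storeNat, natVar_storeNat, natVar_setNat, natArr_setNat,
      e6', e7]
  refine third.seq ?_
  rintro s₄ hf₄ ⟨h8, h6⟩
  have hH₄ := hH₃.frame hf₄ (by decide) (by decide) (by decide) (by decide) (by decide) (by decide)
    (by decide)
  have a1 : s₄.natArr 1 = s.natArr 1 := by
    rw [hf₄.natArr 1 (by decide), hf₃.natArr 1 (by decide), hf₂.natArr 1 (by decide),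
      hf₁.natArr 1 (by decide)]
  have a5 : s₄.natArr 5 = s.natArr 5 := by
    rw [hf₄.natArr 5 (by decide), hf₃.natArr 5 (by decide), hf₂.natArr 5 (by decide),
      hf₁.natArr 5 (by decide)]
  have a8 : s₄.natArr 8 = s₁.natArr 8 := by
    rw [hf₄.natArr 8 (by decide), hf₃.natArr 8 (by decide), hf₂.natArr 8 (by decide)]
  have hAug : Augmenting 𝒟 (s₃.realArr 2) m (s₁.natArr 7) (s₁.natArr 8) (s₄.natArr 6) t
      (s₄.natArr 1) (s₄.natArr 5) := by
    rw [a1, a5, h6]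
    refine ⟨hA.lt, fun h => absurd h ht.ne, fun _ => hA.ge m le_rfl hmn,
      fun d hd hd' => hA.ge d hd.le hd', fun d hd hk => g₁ d ?_, fun i hi => ?_,
      fun _ u hu hur => ?_, hA.row⟩
    · refine lt_of_le_of_ne hd ?_
      rintro rfl
      exact hk.ne (hA.ge d le_rfl hmn)
    · rw [Function.update_apply, hA.count i hi]
      by_cases hti : t = i
      · simp [hti]
      · simp [hti, Ne.symm hti]
    · rcases hS.parent u hu with ⟨hm', -⟩ | ⟨hlt, hk, -, hr, -⟩
      · exact ⟨hm'.le, g₅ u hu hur, .inl (hm' ▸ hA.ge m le_rfl hmn)⟩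
      · exact ⟨hlt.le, g₅ u hu hur, .inr ⟨hk, hr.resolve_left (hdone u hu).1⟩⟩
  refine (walk_ends hV hH₄ hmn a8 h8 hdone ht hAug).imp ?_
  intro s₅ hf₅ hW
  rw [hf₅.realArr 2 (by decide), hf₄.realArr 2 (by decide), hf₅.natArr 6 (by decide)]
  have hlt : ∀ d < m + 1, s₅.natArr 1 d < 𝒟.k := fun d hd => by
    rcases Nat.lt_succ_iff_lt_or_eq.mp hd with hd | rfl
    · exact hW.lt d hd
    · exact hW.self_lt rfl
  refine ⟨hlt, fun d hd hd' => hW.gt d hd hd',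
    fun d hd => hW.prefers d (by omega) (hlt d hd), fun i hi => ?_, fun i hi => ?_,
    fun i hi => ?_, hW.row⟩
  · rw [← hW.count i hi, if_neg (by omega), Nat.add_zero]
  · rw [h6, Function.update_apply]
    split_ifs with hit
    · rw [hit, g₄]
    · exact g₂ i hi
  · rw [h6, Function.update_apply]
    split_ifs with hit
    · rw [hit, g₄]
      -- The price at `t` equals the marginal penalty of the unit just received, so the lower bound
      -- is an equality and the upper one is monotonicity.
      exact hmono t ht (Nat.le_succ _)
    · exact g₃ i hi

/-! ### Initialization -/

theorem table_ends {s : State} {a B c : ℕ} {start step bound : NatExpr}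
    (hstart : start.steps ≤ 9) (hstep : step.steps ≤ 9) (hbound : bound.steps ≤ 9)
    (hB : ∀ v, bound.eval (s.setNat 3 v) = B)
    (hc : ∀ s', (Prog.table a start step bound).Frame s s' → step.eval s' = c) :
    Ends (.table a start step bound) s (B * 30 + 30) fun s' =>
      ∀ x < B, s'.natArr a x = start.eval s + x * c := by
  have first : Ends (.setNat 3 start) s 10 fun s' => s' = s.setNat 3 (start.eval s) :=
    Ends.of_wp (by simp only [Prog.steps]; omega) rfl
  refine (first.seq (T' := 10 + (B * (22 + 8) + 6)) ?_).mono (by omega) fun _ _ h => h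
  rintro s₁ hf₁ hs₁
  have second : Ends (.setNat 2 bound) s₁ 10 fun s' => s'.natVar 2 = B ∧ s'.natVar 3 = start.eval s :=
    Ends.of_wp (by simp only [Prog.steps]; omega)
      (by simp [Prog.wp, natVar_setNat, hs₁, hB])
  refine second.seq ?_
  rintro s₂ hf₂ ⟨h2, h3⟩
  refine (Ends.forLoop (x := 6) (y := 2) (fun J s' => s'.natVar 3 = start.eval s + J * c ∧
    ∀ x < J, s'.natArr a x = start.eval s + x * c)
    (by simp [Prog.forLoop, Prog.natVars]) h2 (by simp [Prog.natVars]) (fun _ _ _ h => h)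
    ⟨by simpa using h3, by simp⟩ ?_).imp fun _ _ h => h.2
  rintro J hJ s' hf hx ⟨h₁, h₂⟩
  refine Ends.of_wp (by simp only [Prog.steps, NatExpr.steps]; omega) ?_
  have hstore : (Prog.storeNat a (.var 6) (.var 3)).Frame s' (s'.storeNat a J (s'.natVar 3)) := by
    have := (Run.storeNat a (.var 6) (.var 3) s').frame
    simpa only [NatExpr.eval, hx] using this
  have hc' := hc (s'.storeNat a J (s'.natVar 3)) (hf₁.seq_left.trans
    (hf₂.seq_left.trans (hf.trans hstore.seq_left.seq_left.loop.seq_right).seq_right).seq_right)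
  simp only [Prog.wp, NatExpr.eval, natVar_setNat, natArr_setNat, natVar_storeNat,
    natArr_storeNat, hx, if_true, h₁] at hc' ⊢
  refine ⟨by rw [hc']; ring, fun x hxJ => ?_⟩
  rcases Nat.lt_succ_iff_lt_or_eq.mp hxJ with hj | rfl
  · rw [Function.update_of_ne hj.ne, h₂ x hj]
  · rw [Function.update_self]

theorem zeroPrices_ends {s : State} {k : ℕ} (hk : s.natVar 1 = k) :
    Ends (.forLoop 6 1 (.storeReal 2 (.var 6) .zero)) s (k * 30 + 30) fun s' =>
      ∀ x < k, s'.realArr 2 x = 0 := by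
  refine (Ends.forLoop (T := 22) (fun J s' => ∀ x < J, s'.realArr 2 x = 0) (by decide) hk
    (by decide) (fun _ _ _ h => h) (by simp) ?_).mono (by omega) fun _ _ h => h
  intro J hJ s' hf hx h₁
  refine Ends.of_wp (by decide) fun x hxJ => ?_
  simp only [NatExpr.eval, RealExpr.eval, realArr_storeReal, hx, if_true]
  rcases Nat.lt_succ_iff_lt_or_eq.mp hxJ with hj | rfl
  · rw [Function.update_of_ne hj.ne, h₁ x hj]
  · rw [Function.update_self]

/-- An upper bound on the number of steps of the initialization. -/
def initBound (n k : ℕ) : ℕ :=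
  ((n + k + 1) * 30 + 30) + (((k * k + 1) * 30 + 30) +
    ((k * k * (2 * n) * 30 + 30) + ((n * 30 + 30) + ((k * 30 + 30) + (k * 30 + 30)))))

theorem init_ends {s : State} {n k : ℕ} (hn : s.natVar 0 = n) (hk : s.natVar 1 = k) :
    Ends .init s (initBound n k) fun s' =>
      (∀ x ≤ n + k, s'.natArr 2 x = x * k) ∧ (∀ x ≤ k * k, s'.natArr 4 x = x * (2 * n)) ∧
      (∀ x < k * k * (2 * n), s'.natArr 5 x = 0) ∧ (∀ x < n, s'.natArr 1 x = k) ∧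
      (∀ x < k, s'.natArr 6 x = 0) ∧ ∀ x < k, s'.realArr 2 x = 0 := by
  have frame : ∀ {p : Prog} {s s' : State}, s.natVar 0 = n → s.natVar 1 = k → p.Frame s s' →
      0 ∉ p.natVars → 1 ∉ p.natVars → s'.natVar 0 = n ∧ s'.natVar 1 = k :=
    fun hn hk hf h₀ h₁ => ⟨(hf.natVar _ h₀).trans hn, (hf.natVar _ h₁).trans hk⟩
  unfold initBound
  refine (table_ends (B := n + k + 1) (c := k) (by decide) (by decide) (by decide)
    (fun v => by simp [NatExpr.eval, natVar_setNat, hn, hk])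
    (fun s' hf => by exact (frame hn hk hf (by decide) (by decide)).2)).seq ?_
  intro s₁ hf₁ h₁
  obtain ⟨hn₁, hk₁⟩ := frame hn hk hf₁ (by decide) (by decide)
  simp only [NatExpr.eval, zero_add] at h₁
  have hkk : s₁.natArr 2 k = k * k := h₁ k (by omega)
  refine (table_ends (B := k * k + 1) (c := 2 * n) (by decide) (by decide) (by decide)
    (fun v => by simp [NatExpr.eval, natVar_setNat, natArr_setNat, hk₁, hkk])
    (fun s' hf => ?_)).seq ?_
  · have := (frame hn₁ hk₁ hf (by decide) (by decide)).1
    simp only [NatExpr.eval, this]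
    ring
  intro s₂ hf₂ h₂
  obtain ⟨hn₂, hk₂⟩ := frame hn₁ hk₁ hf₂ (by decide) (by decide)
  simp only [NatExpr.eval, zero_add] at h₂
  refine (table_ends (B := k * k * (2 * n)) (c := 0) (by decide) (by decide) (by decide)
    (fun v => ?_) (fun s' _ => by rfl)).seq ?_
  · simp only [NatExpr.eval, natVar_setNat, natArr_setNat, hf₂.natArr 2 (by decide)]
    norm_num only [if_false]
    rw [hk₂, hkk, h₂ _ (by omega)]
  intro s₃ hf₃ h₃
  obtain ⟨hn₃, hk₃⟩ := frame hn₂ hk₂ hf₃ (by decide) (by decide)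
  refine (table_ends (B := n) (c := 0) (by decide) (by decide) (by decide)
    (fun v => by simp [NatExpr.eval, natVar_setNat, hn₃]) (fun s' _ => by rfl)).seq ?_
  intro s₄ hf₄ h₄
  obtain ⟨hn₄, hk₄⟩ := frame hn₃ hk₃ hf₄ (by decide) (by decide)
  refine (table_ends (B := k) (c := 0) (by decide) (by decide) (by decide)
    (fun v => by simp [NatExpr.eval, natVar_setNat, hk₄]) (fun s' _ => by rfl)).seq ?_
  intro s₅ hf₅ h₅
  obtain ⟨hn₅, hk₅⟩ := frame hn₄ hk₄ hf₅ (by decide) (by decide)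
  refine (zeroPrices_ends hk₅).imp ?_
  intro s₆ hf₆ h₆
  refine ⟨fun x hx => ?_, fun x hx => ?_, fun x hx => ?_, fun x hx => ?_, fun x hx => ?_, h₆⟩
  · rw [hf₆.natArr 2 (by decide), hf₅.natArr 2 (by decide), hf₄.natArr 2 (by decide),
      hf₃.natArr 2 (by decide), hf₂.natArr 2 (by decide), h₁ x (by omega)]
  · rw [hf₆.natArr 4 (by decide), hf₅.natArr 4 (by decide), hf₄.natArr 4 (by decide),
      hf₃.natArr 4 (by decide), h₂ x (by omega)]
  · rw [hf₆.natArr 5 (by decide), hf₅.natArr 5 (by decide), hf₄.natArr 5 (by decide), h₃ x hx]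
    simp [NatExpr.eval]
  · rw [hf₆.natArr 1 (by decide), hf₅.natArr 1 (by decide), h₄ x hx]
    simp [NatExpr.eval, hk₃]
  · rw [hf₆.natArr 6 (by decide), h₅ x hx]
    simp [NatExpr.eval]

/-! ### The whole algorithm -/

/-- Zero prices certify the empty allotment because marginal penalties start at 0 and increase; a
tree of zeros is one without candidates. -/
theorem Allotment.empty {𝒟 : Data} {δ : ℕ → ℕ → ℝ} {a occ tr : ℕ → ℕ} {y : ℕ → ℝ}
    (hδ : ∀ i < 𝒟.k, δ i 0 = 0) (hmono : ∀ i < 𝒟.k, Monotone (δ i))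
    (ha : ∀ d < 𝒟.n, a d = 𝒟.k) (hocc : ∀ i < 𝒟.k, occ i = 0) (hy : ∀ i < 𝒟.k, y i = 0)
    (htr : ∀ x < 𝒟.k * 𝒟.k * (2 * 𝒟.n), tr x = 0) : Allotment 𝒟 δ 0 a occ y tr where
  lt d hd := absurd hd (Nat.not_lt_zero d)
  ge d _ hd := ha d hd
  prefers d hd := absurd hd (Nat.not_lt_zero d)
  count i hi := by
    rw [hocc i hi, count_eq_zero]
    intro d hd
    rw [ha d hd]
    exact hi.ne'
  lower i hi := by rw [hocc i hi, hy i hi, hδ i hi]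
  upper i hi := by
    rw [hocc i hi, hy i hi, ← hδ i hi]
    exact hmono i hi (Nat.zero_le _)
  row i hi j hj := by
    have h0 : ∀ v < 2 * 𝒟.n, tr ((i * 𝒟.k + j) * (2 * 𝒟.n) + v) = 0 := fun v hv => by
      have h₁ : (i + 1) * 𝒟.k ≤ 𝒟.k * 𝒟.k := Nat.mul_le_mul_right _ hi
      have h₂ : (i * 𝒟.k + j + 1) * (2 * 𝒟.n) ≤ 𝒟.k * 𝒟.k * (2 * 𝒟.n) :=
        Nat.mul_le_mul_right _ (by rw [Nat.add_mul] at h₁; omega)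
      rw [Nat.add_mul _ 1] at h₂
      exact htr _ (by omega)
    refine ⟨fun d hd => ?_, fun v hv hv' _ => ?_⟩
    · rw [h0 _ (by omega), ha d hd, if_neg hi.ne']
    · rw [h0 _ (by omega), h0 _ (by omega), h0 _ (by omega)]
      rfl

theorem insertAll_ends {𝒟 : Data} {s : State} {δ : ℕ → ℕ → ℝ} (hV : 𝒟.Valid) (h : 𝒟.Holds s)
    (hδ : ∀ i < 𝒟.k, ∀ o < 𝒟.n, δ i (o + 1) =
      if o < 𝒟.cap i then 0 else 𝒟.pen (i * 𝒟.n + (o - 𝒟.cap i)))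
    (hmono : ∀ i < 𝒟.k, Monotone (δ i))
    (hA : Allotment 𝒟 δ 0 (s.natArr 1) (s.natArr 6) (s.realArr 2) (s.natArr 5)) :
    Ends (.forLoop 4 0 .insert) s (𝒟.n * (insertBound 𝒟.k (Nat.log 2 (2 * 𝒟.n)) + 8) + 6) fun s' =>
      Allotment 𝒟 δ 𝒟.n (s'.natArr 1) (s'.natArr 6) (s'.realArr 2) (s'.natArr 5) := by
  refine Ends.forLoop (fun m s' =>
    Allotment 𝒟 δ m (s'.natArr 1) (s'.natArr 6) (s'.realArr 2) (s'.natArr 5)) (by decide) h.n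
    (by decide) (fun _ _ _ h => h) hA ?_
  intro m hm s' hf hx hA
  exact insert_ends hV (h.frame hf (by decide) (by decide) (by decide) (by decide) (by decide)
    (by decide) (by decide)) hδ hmono hx hm hA

theorem distribute_ends {s : State} {n k : ℕ} {δ : ℕ → ℕ → ℝ} (hn : s.natVar 0 = n)
    (hk : s.natVar 1 = k) (hn0 : 0 < n) (hk0 : 0 < k)
    (hδ : ∀ i < k, ∀ o < n, δ i (o + 1) =
      if o < s.natArr 0 i then 0 else s.realArr 1 (i * n + (o - s.natArr 0 i)))
    (hδ0 : ∀ i < k, δ i 0 = 0) (hmono : ∀ i < k, Monotone (δ i)) :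
    Ends .distribute s (initBound n k + (n * (insertBound k (Nat.log 2 (2 * n)) + 8) + 6)) fun s' =>
      ∃ (𝒟 : Data) (occ : ℕ → ℕ) (y : ℕ → ℝ) (tr : ℕ → ℕ), 𝒟.n = n ∧ 𝒟.k = k ∧
        𝒟.cost = s.realArr 0 ∧ Allotment 𝒟 δ n (s'.natArr 1) occ y tr := by
  refine (init_ends hn hk).seq ?_
  rintro s₁ hf₁ ⟨h2, h4, h5, h1, h6, hy⟩
  have hH : (Data.mk n k (s.natArr 0) (s₁.natArr 2) (s₁.natArr 4) (s.realArr 0)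
      (s.realArr 1)).Holds s₁ := ⟨(hf₁.natVar 0 (by decide)).trans hn,
    (hf₁.natVar 1 (by decide)).trans hk, hf₁.natArr 0 (by decide), rfl, rfl,
    hf₁.realArr 0 (by decide), hf₁.realArr 1 (by decide)⟩
  exact (insertAll_ends ⟨hn0, hk0, h2, h4⟩ hH hδ hmono (.empty hδ0 hmono h1 h6 hy h5)).imp
    fun s' _ h => ⟨_, _, _, _, rfl, rfl, rfl, h⟩

/-! ### Estimates of the step count. -/

theorem initBound_add_insertBound_le {n k : ℕ} (hn : 0 < n) (hk : 0 < k) (l : ℕ) :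
    initBound n k + (n * (insertBound k l + 8) + 6) ≤
      2000 * (n * k ^ 3) + 200 * (n * k ^ 2 * l) := by
  -- Every term free of `l` is at most a multiple of `n * k ^ 2`; the cube is needed only for the
  -- form of the claimed bound.
  have h₁ : n * k ^ 2 ≤ n * k ^ 3 := Nat.mul_le_mul_left _ (Nat.pow_le_pow_right hk (by norm_num))
  have h₂ : n * k ≤ n * k ^ 2 := Nat.mul_le_mul_left _ (Nat.le_self_pow (by norm_num) k)
  have h₃ : n ≤ n * k := Nat.le_mul_of_pos_right _ hk
  have h₄ : k ≤ n * k := Nat.le_mul_of_pos_left _ hn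
  have h₅ : k ^ 2 ≤ n * k ^ 2 := Nat.le_mul_of_pos_left _ hn
  unfold initBound insertBound
  nlinarith [Nat.zero_le (n * k ^ 2 * l)]

theorem log_two_mul_le {n : ℕ} (hn : 0 < n) : (Nat.log 2 (2 * n) : ℝ) ≤ 1 + 2 * Real.log n := by
  have h₁ : Nat.log 2 (2 * n) = Nat.log 2 n + 1 := by
    rw [mul_comm]
    exact Nat.log_mul_base (by norm_num) hn.ne'
  have h₂ : (Nat.log 2 n : ℝ) ≤ Real.logb 2 n := by
    exact_mod_cast Real.natLog_le_logb n 2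
  have h₃ : Real.logb 2 n ≤ 2 * Real.log n := by
    have hlog : 0 ≤ Real.log n := Real.log_natCast_nonneg n
    -- Only `1 / 2 ≤ log 2` matters; it gives the factor 2.
    have := Real.log_two_gt_d9
    rw [Real.logb, div_le_iff₀ (by linarith)]
    nlinarith
  rw [h₁]
  push_cast
  linarith

theorem occupancy_eq_count {n k : ℕ} {A : Fin n → Fin k} {a : ℕ → ℕ} (h : ∀ d : Fin n, a d = A d)
    (i : Fin k) : occupancy A i = count n a i := by
  unfold occupancy allotted count
  rw [Finset.card_filter, Finset.card_filter,
    ← Fin.sum_univ_eq_sum_range (fun d => if a d = i then 1 else 0)]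
  exact Finset.sum_congr rfl fun d _ => by simp [h, Fin.ext_iff]

theorem Inst.distribute_ends {n k : ℕ} (hn : 0 < n) (hk : 0 < k) (I : Inst n k) {s : State}
    (hs : I.LoadedIn s) :
    Ends .distribute s (initBound n k + (n * (insertBound k (Nat.log 2 (2 * n)) + 8) + 6)) fun s' =>
      ∃ A : Fin n → Fin k, Outputs A s' ∧ I.IsOptimal A := by
  -- Marginal penalties are extended by 0 to indices that are not centers, since the program works
  -- with plain natural numbers.
  refine (LBDD.distribute_ends (δ := fun i o => if h : i < k then I.marginal ⟨i, h⟩ o else 0)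
    hs.demandCount hs.centerCount hn hk (fun i hi o ho => ?_)
    (fun i hi => by simp [hi, I.marginal_zero])
    (fun i hi => by simpa [hi] using I.marginal_mono ⟨i, hi⟩)).imp ?_
  · have hcap := hs.capacities ⟨i, hi⟩
    simp only [hi, dif_pos, Inst.marginal, min_eq_left (show o + 1 ≤ n from ho)] at hcap ⊢
    rw [hcap]
    split_ifs with h₁ h₂ h₂
    · rfl
    · omega
    · omega
    · rw [hs.penalties ⟨i, hi⟩ _ (by omega)]
      congr 1
      omega
  · rintro s' - ⟨𝒟, occ, y, tr, rfl, rfl, hcost, hA⟩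
    let A : Fin 𝒟.n → Fin 𝒟.k := fun d => ⟨s'.natArr 1 d, hA.lt d d.2⟩
    have hC : ∀ (d : Fin 𝒟.n) (i : Fin 𝒟.k), 𝒟.C d i = I.cost d i := fun d i => by
      rw [Data.C, hcost, hs.costs]
    have hocc : ∀ i : Fin 𝒟.k, occ i = occupancy A i := fun i => by
      rw [occupancy_eq_count (a := s'.natArr 1) (fun _ => rfl), hA.count i i.2]
    refine ⟨A, fun _ => rfl, I.isOptimal_of_prices A (fun i => y i) (fun d i => ?_) (fun i => ?_)
      (fun i => ?_)⟩
    · have := hA.prefers d d.2 i i.2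
      rwa [hC, show s'.natArr 1 d = A d from rfl, hC] at this
    · simpa [hocc] using hA.lower i i.2
    · simpa [hocc] using hA.upper i i.2

end LBDD

theorem mainTheorem1 :
    ∃ (p : LBDD.Prog) (C : ℝ), ∀ (n k : ℕ), 0 < n → 0 < k →
      ∀ (I : LBDD.Inst n k) (s : LBDD.State), I.LoadedIn s →
        ∃ (t : ℕ) (s' : LBDD.State) (A : Fin n → Fin k),
          LBDD.Run p s t s' ∧ LBDD.Outputs A s' ∧ I.IsOptimal A ∧
            (t : ℝ) ≤ C * ((n : ℝ) * (k : ℝ) ^ 3 + (n : ℝ) * (k : ℝ) ^ 2 * Real.log n) := by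
  -- The constant is 2000 plus the 200 from the summand 1 in `log_two_mul_le`, which `n * k ^ 3`
  -- absorbs; this matters for `n = 1`, where the logarithm vanishes.
  refine ⟨.distribute, 2200, fun n k hn hk I s hs => ?_⟩
  obtain ⟨t, s', hr, ht, A, hout, hopt⟩ := I.distribute_ends hn hk hs
  refine ⟨t, s', A, hr, hout, hopt, ?_⟩
  have h₁ : (t : ℝ) ≤ 2000 * (n * k ^ 3) + 200 * (n * k ^ 2 * (Nat.log 2 (2 * n) : ℕ)) := by
    exact_mod_cast ht.trans (LBDD.initBound_add_insertBound_le hn hk _)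
  have h₂ : (n : ℝ) * k ^ 2 * (Nat.log 2 (2 * n) : ℕ) ≤ n * k ^ 2 * (1 + 2 * Real.log n) :=
    mul_le_mul_of_nonneg_left (LBDD.log_two_mul_le hn) (by positivity)
  have h₃ : (n : ℝ) * k ^ 2 ≤ n * k ^ 3 := by
    exact_mod_cast Nat.mul_le_mul_left _ (Nat.pow_le_pow_right hk (by norm_num))
  have h₄ : 0 ≤ (n : ℝ) * k ^ 2 * Real.log n :=
    mul_nonneg (by positivity) (Real.log_natCast_nonneg n)
  nlinarith
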